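/- **Setting.** For $\varepsilon>0$ let $\mathcal D_\varepsilon$ be the Fréchet space of smooth functions $f:\mathbb R\to\mathbb C$ with $$p_{j,\varepsilon}(f)^2=\int_{\mathbb R}e^{\varepsilon x^2}|f^{(j)}(x)|^2\,dx<\infty\qquad(j\ge 0),$$ topologized by the seminorms $p_{j,\varepsilon}$. For $m\in\mathbb N$ let $\Sigma^{(m)}$ be the Fréchet space of symbols of order $m$, i.e. of smooth functions $f:\mathbb R\to\mathbb C$ with $$\sup_{x\in\mathbb R}(1+|x|)^{j-m}|f^{(j)}(x)|<\infty\qquad(j\ge 0),$$ topologized by these suprema. Let $\widehat\otimes$ be the completed projective tensor product of locally convex spaces. For $n\ge 0$, $0\le k\le n$ and $m_0,\dots,m_n\in\mathbb N$ with $m_k\ge 1$ put $$\mathcal F_k(m_0,\dots,m_n)=\Sigma^{(m_0)}\widehat\otimes\cdots\widehat\otimes\Sigma^{(m_{k-1})}\widehat\otimes\mathcal D_{1/m_k}\widehat\otimes\Sigma^{(m_{k+1})}\widehat\otimes\cdots\widehat\otimes\Sigma^{(m_n)},$$ and let $\mathcal F_k^{(n)}=\varinjlim\mathcal F_k(m_0,\dots,m_n)$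 be the locally convex inductive limit as all $m_j\to\infty$, with respect to the maps induced by the inclusions $\Sigma^{(m)}\subset\Sigma^{(m')}$ and $\mathcal D_{1/m}\subset\mathcal D_{1/m'}$ for $m\le m'$. Give $C^\infty(\mathbb R^{n+1})$ (complex-valued functions) the topology of uniform convergence of all derivatives on compact sets. **Proposition.** For every $n\ge 0$ and every $0\le k\le n$ there is exactly one continuous linear map $$\Phi_k:\mathcal F_k^{(n)}\to C^\infty(\mathbb R^{n+1})$$ that sends the class of every elementary tensor $f_0\otimes\cdots\otimes f_n\in\mathcal F_k(m_0,\dots,m_n)$ to the function $(x_0,\dots,x_n)\mapsto f_0(x_0)\cdots f_n(x_n)$ (the natural map), and $\Phi_k$ is injective. Consequently each $\mathcal F_k^{(n)}$ is identified with a linear subspace of $C^\infty(\mathbb R^{n+1})$, and $\mathcal F^{(n)}=\sum_{k=0}^n\mathcal F_k^{(n)}$, that is $\sum_{k=0}^n\Phi_k(\mathcal F_k^{(n)})$, is a well-defined linear subspace of $C^\infty(\mathbb R^{n+1})$. -/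

import Mathlib

open MeasureTheory
open scoped ContDiff TensorProduct

noncomputable section

namespace TensorSymbol

/-! ### Function spaces on the line with their seminorms -/

/-- A complex vector space of functions on `ℝ` with a sequence of seminorms, which generate its
locally convex topology. -/
structure FunctionSpace where
  carrier : Submodule ℂ (ℝ → ℂ)
  seminorms : ℕ → Seminorm ℂ carrier

/-- The elements of a function space, as a type that carries the topology of the seminorms (and
not the topology of pointwise convergence inherited from `ℝ → ℂ`). -/
def FunctionSpace.Elem (X : FunctionSpace) : Type := X.carrier

namespace FunctionSpace

instance (X : FunctionSpace) : AddCommGroup X.Elem := inferInstanceAs (AddCommGroup X.carrier)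

instance (X : FunctionSpace) : Module ℂ X.Elem := inferInstanceAs (Module ℂ X.carrier)

instance (X : FunctionSpace) : CoeFun X.Elem (fun _ => ℝ → ℂ) := ⟨fun f => Subtype.val f⟩

/-- The seminorms, as a family on the type of elements. -/
def family (X : FunctionSpace) : SeminormFamily ℂ X.Elem ℕ := X.seminorms

instance (X : FunctionSpace) : TopologicalSpace X.Elem := X.family.moduleFilterBasis.topology

theorem withSeminorms (X : FunctionSpace) : WithSeminorms X.family := ⟨rfl⟩

/-- `X` is contained in `Y`, and each seminorm of `Y` is dominated on `X` by the same seminorm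
of `X`. -/
def Le (X Y : FunctionSpace) : Prop :=
  ∃ h : X.carrier ≤ Y.carrier,
    ∀ (i : ℕ) (f : X.carrier), Y.seminorms i (Submodule.inclusion h f) ≤ X.seminorms i f

/-- The inclusion of function spaces, as a linear map. -/
def inclLinear {X Y : FunctionSpace} (h : X.Le Y) : X.Elem →ₗ[ℂ] Y.Elem :=
  (Submodule.inclusion h.1 : X.carrier →ₗ[ℂ] Y.carrier)

/-- The inclusion of function spaces, as a continuous linear map. -/
def incl {X Y : FunctionSpace} (h : X.Le Y) : X.Elem →L[ℂ] Y.Elem where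
  toLinearMap := inclLinear h
  cont := by
    refine X.withSeminorms.continuous_of_isBounded Y.withSeminorms (inclLinear h) ?_
    intro i
    refine ⟨{i}, 1, ?_⟩
    intro f
    have hi : Y.family i (inclLinear h f) ≤ X.family i f := h.2 i f
    simpa using hi

end FunctionSpace

theorem iteratedDeriv_add_of_smooth {f g : ℝ → ℂ} (hf : ContDiff ℝ ∞ f) (hg : ContDiff ℝ ∞ g)
    (k : ℕ) (x : ℝ) :
    iteratedDeriv k (f + g) x = iteratedDeriv k f x + iteratedDeriv k g x :=
  iteratedDeriv_add (hf.of_le (by exact_mod_cast le_top)).contDiffAt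
    (hg.of_le (by exact_mod_cast le_top)).contDiffAt

/-! ### Symbols of order `m` -/

/-- The smooth functions `f` on `ℝ` with `|f⁽ᵏ⁾(x)| ≤ C_k (1 + |x|) ^ (m - k)` for all `k`. -/
def symbolCarrier (m : ℤ) : Submodule ℂ (ℝ → ℂ) where
  carrier := {f | ContDiff ℝ ∞ f ∧
    ∀ k : ℕ, ∃ C : ℝ, ∀ x, ‖iteratedDeriv k f x‖ ≤ C * (1 + |x|) ^ (m - k)}
  zero_mem' := by
    refine ⟨contDiff_const, fun k => ⟨0, fun x => ?_⟩⟩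
    have h := iteratedDeriv_const_smul_field (n := k) (x := x) (0 : ℂ) (0 : ℝ → ℂ)
    simp only [zero_smul] at h
    simp [h]
  add_mem' := by
    rintro f g ⟨hf, hf'⟩ ⟨hg, hg'⟩
    refine ⟨hf.add hg, fun k => ?_⟩
    obtain ⟨C, hC⟩ := hf' k
    obtain ⟨D, hD⟩ := hg' k
    refine ⟨C + D, fun x => ?_⟩
    rw [iteratedDeriv_add_of_smooth hf hg, add_mul]
    exact (norm_add_le _ _).trans (add_le_add (hC x) (hD x))
  smul_mem' := by
    rintro c f ⟨hf, hf'⟩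
    refine ⟨contDiff_const.smul hf, fun k => ?_⟩
    obtain ⟨C, hC⟩ := hf' k
    refine ⟨‖c‖ * C, fun x => ?_⟩
    rw [iteratedDeriv_const_smul_field, norm_smul, mul_assoc]
    exact mul_le_mul_of_nonneg_left (hC x) (norm_nonneg c)

theorem symbol_weight_mul (m : ℤ) (k : ℕ) (x : ℝ) :
    (1 + |x|) ^ (k - m : ℤ) * (1 + |x|) ^ (m - k : ℤ) = 1 := by
  have h : (1 + |x|) ≠ 0 := by positivity
  rw [← zpow_add₀ h]
  simp

theorem symbol_bddAbove {m : ℤ} (f : symbolCarrier m) (k : ℕ) :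
    BddAbove (Set.range fun x : ℝ => (1 + |x|) ^ (k - m : ℤ) * ‖iteratedDeriv k f.1 x‖) := by
  obtain ⟨C, hC⟩ := f.2.2 k
  refine ⟨C, ?_⟩
  rintro _ ⟨x, rfl⟩
  calc (1 + |x|) ^ (k - m : ℤ) * ‖iteratedDeriv k f.1 x‖
      ≤ (1 + |x|) ^ (k - m : ℤ) * (C * (1 + |x|) ^ (m - k : ℤ)) :=
        mul_le_mul_of_nonneg_left (hC x) (by positivity)
    _ = C * ((1 + |x|) ^ (k - m : ℤ) * (1 + |x|) ^ (m - k : ℤ)) := by ring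
    _ = C := by rw [symbol_weight_mul, mul_one]

/-- The seminorm `f ↦ sup_x (1 + |x|) ^ (k - m) |f⁽ᵏ⁾(x)|`. -/
def symbolSeminorm (m : ℤ) (k : ℕ) : Seminorm ℂ (symbolCarrier m) :=
  Seminorm.of (fun f => ⨆ x : ℝ, (1 + |x|) ^ (k - m : ℤ) * ‖iteratedDeriv k f.1 x‖)
    (by
      intro f g
      refine ciSup_le fun x => ?_
      have h1 := le_ciSup (symbol_bddAbove f k) x
      have h2 := le_ciSup (symbol_bddAbove g k) x
      have h3 : iteratedDeriv k (f + g).1 x = iteratedDeriv k f.1 x + iteratedDeriv k g.1 x :=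
        iteratedDeriv_add_of_smooth f.2.1 g.2.1 k x
      rw [h3]
      refine le_trans ?_ (add_le_add h1 h2)
      rw [← mul_add]
      exact mul_le_mul_of_nonneg_left (norm_add_le _ _) (by positivity))
    (by
      intro c f
      rw [Real.mul_iSup_of_nonneg (norm_nonneg c)]
      congr 1
      ext x
      have h3 : iteratedDeriv k (c • f).1 x = c • iteratedDeriv k f.1 x :=
        iteratedDeriv_const_smul_field c f.1
      rw [h3, norm_smul]
      ring)

/-- The Fréchet space `Σ^(m)` of symbols of order `m` on `ℝ`. -/
def symbolSpace (m : ℤ) : FunctionSpace := ⟨symbolCarrier m, symbolSeminorm m⟩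

theorem symbolSpace_le {m m' : ℤ} (h : m ≤ m') : (symbolSpace m).Le (symbolSpace m') := by
  refine ⟨?_, ?_⟩
  · rintro f ⟨hf, hf'⟩
    refine ⟨hf, fun k => ?_⟩
    obtain ⟨C, hC⟩ := hf' k
    refine ⟨|C|, fun x => (hC x).trans ?_⟩
    have h1 : (1 : ℝ) ≤ 1 + |x| := by linarith [abs_nonneg x]
    exact mul_le_mul (le_abs_self C) (zpow_le_zpow_right₀ h1 (by omega)) (by positivity)
      (abs_nonneg C)
  · intro k f
    refine ciSup_le fun x => ?_
    refine le_trans ?_ (le_ciSup (symbol_bddAbove f k) x)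
    have h1 : (1 : ℝ) ≤ 1 + |x| := by linarith [abs_nonneg x]
    exact mul_le_mul_of_nonneg_right (zpow_le_zpow_right₀ h1 (by omega)) (norm_nonneg _)

/-! ### Functions of Gaussian decay -/

/-- The derivative `f⁽ᵏ⁾` multiplied by the square root of the weight `exp (ε x²)`. -/
def weightedDeriv (ε : ℝ) (k : ℕ) (f : ℝ → ℂ) (x : ℝ) : ℂ :=
  Real.exp (ε * x ^ 2 / 2) • iteratedDeriv k f x

theorem norm_weightedDeriv_sq (ε : ℝ) (k : ℕ) (f : ℝ → ℂ) (x : ℝ) :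
    ‖weightedDeriv ε k f x‖ ^ 2 = Real.exp (ε * x ^ 2) * ‖iteratedDeriv k f x‖ ^ 2 := by
  rw [weightedDeriv, norm_smul, mul_pow, Real.norm_eq_abs, Real.abs_exp, ← Real.exp_nat_mul]
  congr 2
  push_cast
  ring

theorem weightedDeriv_memLp_iff (ε : ℝ) (k : ℕ) {f : ℝ → ℂ} (hf : ContDiff ℝ ∞ f) :
    MemLp (weightedDeriv ε k f) 2 ↔
      Integrable fun x : ℝ => Real.exp (ε * x ^ 2) * ‖iteratedDeriv k f x‖ ^ 2 := by
  have hc : Continuous (iteratedDeriv k f) :=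
    hf.continuous_iteratedDeriv k (by exact_mod_cast le_top)
  have hm : AEStronglyMeasurable (weightedDeriv ε k f) volume :=
    Continuous.aestronglyMeasurable (by unfold weightedDeriv; fun_prop)
  rw [memLp_two_iff_integrable_sq_norm hm]
  simp only [norm_weightedDeriv_sq]

theorem weightedDeriv_add (ε : ℝ) (k : ℕ) {f g : ℝ → ℂ} (hf : ContDiff ℝ ∞ f)
    (hg : ContDiff ℝ ∞ g) :
    weightedDeriv ε k (f + g) = weightedDeriv ε k f + weightedDeriv ε k g := by
  ext x
  simp only [weightedDeriv, Pi.add_apply, iteratedDeriv_add_of_smooth hf hg, smul_add]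

theorem weightedDeriv_smul (ε : ℝ) (k : ℕ) (c : ℂ) (f : ℝ → ℂ) :
    weightedDeriv ε k (c • f) = c • weightedDeriv ε k f := by
  ext x
  simp only [weightedDeriv, Pi.smul_apply, iteratedDeriv_const_smul_field]
  rw [smul_comm]

/-- The smooth functions `f` on `ℝ` with `∫ exp (ε x²) |f⁽ᵏ⁾(x)|² dx < ∞` for all `k`. -/
def decayCarrier (ε : ℝ) : Submodule ℂ (ℝ → ℂ) where
  carrier := {f | ContDiff ℝ ∞ f ∧
    ∀ k : ℕ, Integrable fun x : ℝ => Real.exp (ε * x ^ 2) * ‖iteratedDeriv k f x‖ ^ 2}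
  zero_mem' := by
    have h0 : ContDiff ℝ ∞ (0 : ℝ → ℂ) := contDiff_const
    refine ⟨h0, fun k => (weightedDeriv_memLp_iff ε k h0).1 ?_⟩
    have h := weightedDeriv_smul ε k 0 0
    simp only [zero_smul] at h
    rw [h]
    exact MemLp.zero'
  add_mem' := by
    rintro f g ⟨hf, hf'⟩ ⟨hg, hg'⟩
    refine ⟨hf.add hg, fun k => (weightedDeriv_memLp_iff ε k (f := f + g) (hf.add hg)).1 ?_⟩
    rw [weightedDeriv_add ε k hf hg]
    exact ((weightedDeriv_memLp_iff ε k hf).2 (hf' k)).add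
      ((weightedDeriv_memLp_iff ε k hg).2 (hg' k))
  smul_mem' := by
    rintro c f ⟨hf, hf'⟩
    have hcf : ContDiff ℝ ∞ (c • f) := contDiff_const.smul hf
    refine ⟨hcf, fun k => (weightedDeriv_memLp_iff ε k hcf).1 ?_⟩
    rw [weightedDeriv_smul]
    exact ((weightedDeriv_memLp_iff ε k hf).2 (hf' k)).const_smul c

theorem decay_memLp {ε : ℝ} (f : decayCarrier ε) (k : ℕ) : MemLp (weightedDeriv ε k f.1) 2 :=
  (weightedDeriv_memLp_iff ε k f.2.1).2 (f.2.2 k)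

theorem decay_sqrt_eq {ε : ℝ} (f : decayCarrier ε) (k : ℕ) :
    √(∫ x : ℝ, Real.exp (ε * x ^ 2) * ‖iteratedDeriv k f.1 x‖ ^ 2) =
      (eLpNorm (weightedDeriv ε k f.1) 2 volume).toReal := by
  rw [(decay_memLp f k).eLpNorm_eq_integral_rpow_norm (by norm_num) (by norm_num),
    ENNReal.toReal_ofReal (by positivity), Real.sqrt_eq_rpow]
  simp [← norm_weightedDeriv_sq]

/-- The seminorm `f ↦ (∫ exp (ε x²) |f⁽ᵏ⁾(x)|² dx) ^ (1/2)`. -/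
def decaySeminorm (ε : ℝ) (k : ℕ) : Seminorm ℂ (decayCarrier ε) :=
  Seminorm.of (fun f => √(∫ x : ℝ, Real.exp (ε * x ^ 2) * ‖iteratedDeriv k f.1 x‖ ^ 2))
    (by
      intro f g
      have h : weightedDeriv ε k (f + g).1 = weightedDeriv ε k f.1 + weightedDeriv ε k g.1 :=
        weightedDeriv_add ε k f.2.1 g.2.1
      simp only [decay_sqrt_eq]
      rw [h, ← ENNReal.toReal_add (decay_memLp f k).2.ne (decay_memLp g k).2.ne]
      exact ENNReal.toReal_mono
        (ENNReal.add_ne_top.2 ⟨(decay_memLp f k).2.ne, (decay_memLp g k).2.ne⟩)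
        (eLpNorm_add_le (decay_memLp f k).1 (decay_memLp g k).1 (by norm_num)))
    (by
      intro c f
      have h : weightedDeriv ε k (c • f).1 = c • weightedDeriv ε k f.1 :=
        weightedDeriv_smul ε k c f.1
      simp only [decay_sqrt_eq]
      rw [h, eLpNorm_const_smul, ENNReal.toReal_mul]
      simp)

/-- The Fréchet space `𝒟_ε` of functions of Gaussian decay. -/
def decaySpace (ε : ℝ) : FunctionSpace := ⟨decayCarrier ε, decaySeminorm ε⟩

theorem decaySpace_le {ε ε' : ℝ} (h : ε' ≤ ε) : (decaySpace ε).Le (decaySpace ε') := by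
  have key : ∀ (k : ℕ) (f : ℝ → ℂ) (x : ℝ),
      Real.exp (ε' * x ^ 2) * ‖iteratedDeriv k f x‖ ^ 2 ≤
        Real.exp (ε * x ^ 2) * ‖iteratedDeriv k f x‖ ^ 2 := fun k f x => by gcongr
  have hle : decayCarrier ε ≤ decayCarrier ε' := by
    rintro f ⟨hf, hf'⟩
    refine ⟨hf, fun k => (hf' k).mono' ?_ ?_⟩
    · have hc : Continuous (iteratedDeriv k f) :=
        hf.continuous_iteratedDeriv k (by exact_mod_cast le_top)
      exact Continuous.aestronglyMeasurable (by fun_prop)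
    · refine Filter.Eventually.of_forall fun x => ?_
      rw [Real.norm_of_nonneg (by positivity)]
      exact key k f x
  refine ⟨hle, fun k f => Real.sqrt_le_sqrt ?_⟩
  exact integral_mono ((hle f.2).2 k) (f.2.2 k) (key k f.1)

/-! ### The completed projective tensor product -/

section Projective

variable {ι : Type} (E : ι → Type) [∀ i, AddCommGroup (E i)] [∀ i, Module ℂ (E i)]

/-- The algebraic tensor product of the spaces `E i` over `ℂ`, as a type that carries the
projective topology. -/
def ProjTensor : Type := ⨂[ℂ] i, E i

instance : AddCommGroup (ProjTensor E) := inferInstanceAs (AddCommGroup (⨂[ℂ] i, E i))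

instance : Module ℂ (ProjTensor E) := inferInstanceAs (Module ℂ (⨂[ℂ] i, E i))

/-- The elementary tensors. -/
def ProjTensor.tprod : MultilinearMap ℂ E (ProjTensor E) := PiTensorProduct.tprod ℂ

variable [∀ i, TopologicalSpace (E i)]

/-- All the seminorms on the tensor product that are continuous on elementary tensors. They
generate the finest locally convex topology for which the canonical multilinear map
`(x_i) ↦ ⨂ x_i` is continuous, which is the projective topology. -/
def projFamily : SeminormFamily ℂ (ProjTensor E)
    {p : Seminorm ℂ (ProjTensor E) // Continuous fun x : ∀ i, E i => p (ProjTensor.tprod E x)} :=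
  fun p => p.1

instance : Nonempty
    {p : Seminorm ℂ (ProjTensor E) // Continuous fun x : ∀ i, E i => p (ProjTensor.tprod E x)} :=
  ⟨⟨0, continuous_const⟩⟩

instance : UniformSpace (ProjTensor E) :=
  @IsTopologicalAddGroup.rightUniformSpace (ProjTensor E) _
    (projFamily E).moduleFilterBasis.topology
    (projFamily E).moduleFilterBasis.toAddGroupFilterBasis.isTopologicalAddGroup

theorem projTensor_withSeminorms : WithSeminorms (projFamily E) := ⟨rfl⟩

instance : IsTopologicalAddGroup (ProjTensor E) :=
  (projTensor_withSeminorms E).topologicalAddGroup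

instance : IsUniformAddGroup (ProjTensor E) := isUniformAddGroup_of_addCommGroup

instance : ContinuousSMul ℂ (ProjTensor E) := (projTensor_withSeminorms E).continuousSMul

instance : UniformContinuousConstSMul ℂ (ProjTensor E) :=
  uniformContinuousConstSMul_of_continuousConstSMul ℂ (ProjTensor E)

/-- The completed projective tensor product: the Hausdorff completion for the projective
topology. -/
abbrev ComplTensor : Type := UniformSpace.Completion (ProjTensor E)

variable {E}

/-- The elementary tensor `⨂ x_i` in the completed projective tensor product. -/
def elemTensor (x : ∀ i, E i) : ComplTensor E := ((ProjTensor.tprod E x : ProjTensor E) :)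

variable {F : ι → Type} [∀ i, AddCommGroup (F i)] [∀ i, Module ℂ (F i)]
  [∀ i, TopologicalSpace (F i)]

/-- The tensor product `⨂ u_i` of continuous linear maps, before completion, as a linear map. -/
def ProjTensor.mapLinear (u : ∀ i, E i →L[ℂ] F i) : ProjTensor E →ₗ[ℂ] ProjTensor F :=
  (PiTensorProduct.map (fun i => (u i).toLinearMap) : (⨂[ℂ] i, E i) →ₗ[ℂ] (⨂[ℂ] i, F i))

theorem ProjTensor.mapLinear_tprod (u : ∀ i, E i →L[ℂ] F i) (x : ∀ i, E i) :
    ProjTensor.mapLinear u (ProjTensor.tprod E x) = ProjTensor.tprod F fun i => u i (x i) :=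
  PiTensorProduct.map_tprod _ x

/-- The tensor product `⨂ u_i` of continuous linear maps, before completion, as a continuous
linear map. -/
def ProjTensor.map (u : ∀ i, E i →L[ℂ] F i) : ProjTensor E →L[ℂ] ProjTensor F where
  toLinearMap := ProjTensor.mapLinear u
  cont := by
    refine (projTensor_withSeminorms F).continuous_of_continuous_comp (ProjTensor.mapLinear u) ?_
    rintro ⟨p, hp⟩
    have hq : Continuous fun x : ∀ i, E i =>
        p.comp (ProjTensor.mapLinear u) (ProjTensor.tprod E x) := by
      simp only [Seminorm.comp_apply, ProjTensor.mapLinear_tprod]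
      exact hp.comp (continuous_pi fun i => (u i).continuous.comp (continuous_apply i))
    exact (projTensor_withSeminorms E).continuous_seminorm ⟨p.comp (ProjTensor.mapLinear u), hq⟩

end Projective

/-! ### The spaces `𝓕_k(m₀, …, m_n)` and their inductive limit `𝓕_k⁽ⁿ⁾` -/

/-- The multi-indices `(m₀, …, m_n)` of natural numbers, ordered componentwise; `m_k` is positive
since `1 / m_k` is used. -/
abbrev MultiIndex (n : ℕ) (k : Fin (n + 1)) : Type := {m : Fin (n + 1) → ℕ // 0 < m k}

/-- The `j`-th tensor factor of `𝓕_k(m₀, …, m_n)`: `𝒟_{1/m_k}` for `j = k`, and `Σ^(m_j)`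
otherwise. -/
def factor {n : ℕ} (k : Fin (n + 1)) (m : MultiIndex n k) (j : Fin (n + 1)) : FunctionSpace :=
  if j = k then decaySpace (1 / (m.1 j : ℝ)) else symbolSpace (m.1 j)

theorem factor_le {n : ℕ} {k : Fin (n + 1)} {m m' : MultiIndex n k} (h : m ≤ m')
    (j : Fin (n + 1)) : (factor k m j).Le (factor k m' j) := by
  have hj : m.1 j ≤ m'.1 j := h j
  unfold factor
  split_ifs with hjk
  · subst hjk
    have h0 : (0 : ℝ) < m.1 j := by exact_mod_cast m.2
    exact decaySpace_le (one_div_le_one_div_of_le h0 (by exact_mod_cast hj))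
  · exact symbolSpace_le (by exact_mod_cast hj)

/-- The completed projective tensor product
`𝓕_k(m₀, …, m_n) = Σ^(m₀) ⊗̂ ⋯ ⊗̂ 𝒟_{1/m_k} ⊗̂ ⋯ ⊗̂ Σ^(m_n)`. -/
abbrev FStep {n : ℕ} (k : Fin (n + 1)) (m : MultiIndex n k) : Type :=
  ComplTensor fun j => (factor k m j).Elem

/-- The map `𝓕_k(m₀, …, m_n) → 𝓕_k(m₀', …, m_n')` induced by the inclusions of the factors. -/
def transition {n : ℕ} (k : Fin (n + 1)) (m m' : MultiIndex n k) (h : m ≤ m') :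
    FStep k m →ₗ[ℂ] FStep k m' :=
  (ProjTensor.map fun j => FunctionSpace.incl (factor_le h j)).completion.toLinearMap

/-- The inductive limit `𝓕_k⁽ⁿ⁾` of the spaces `𝓕_k(m₀, …, m_n)`. -/
def FLim (n : ℕ) (k : Fin (n + 1)) : Type := Module.DirectLimit (FStep k) (transition k)

instance (n : ℕ) (k : Fin (n + 1)) : AddCommGroup (FLim n k) :=
  inferInstanceAs (AddCommGroup (Module.DirectLimit (FStep k) (transition k)))

instance (n : ℕ) (k : Fin (n + 1)) : Module ℂ (FLim n k) :=
  inferInstanceAs (Module ℂ (Module.DirectLimit (FStep k) (transition k)))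

/-- The canonical map `𝓕_k(m₀, …, m_n) → 𝓕_k⁽ⁿ⁾`. -/
def FLim.of {n : ℕ} (k : Fin (n + 1)) (m : MultiIndex n k) : FStep k m →ₗ[ℂ] FLim n k :=
  Module.DirectLimit.of ℂ (MultiIndex n k) (FStep k) (transition k) m

/-- All the seminorms on `𝓕_k⁽ⁿ⁾` that are continuous on each `𝓕_k(m₀, …, m_n)`. They generate
the (locally convex) inductive limit topology. -/
def limFamily (n : ℕ) (k : Fin (n + 1)) : SeminormFamily ℂ (FLim n k)
    {p : Seminorm ℂ (FLim n k) // ∀ m, Continuous fun t : FStep k m => p (FLim.of k m t)} :=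
  fun p => p.1

instance (n : ℕ) (k : Fin (n + 1)) : Nonempty
    {p : Seminorm ℂ (FLim n k) // ∀ m, Continuous fun t : FStep k m => p (FLim.of k m t)} :=
  ⟨⟨0, fun _ => continuous_const⟩⟩

instance (n : ℕ) (k : Fin (n + 1)) : TopologicalSpace (FLim n k) :=
  (limFamily n k).moduleFilterBasis.topology

/-! ### The space `C^∞(ℝᴺ)` -/

/-- The smooth complex functions on `ℝᴺ`. -/
def smoothCarrier (N : ℕ) : Submodule ℂ ((Fin N → ℝ) → ℂ) where
  carrier := {f | ContDiff ℝ ∞ f}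
  zero_mem' := (contDiff_const : ContDiff ℝ ∞ fun _ => (0 : ℂ))
  add_mem' := fun {f g} (hf : ContDiff ℝ ∞ f) (hg : ContDiff ℝ ∞ g) => hf.add hg
  smul_mem' := fun c f (hf : ContDiff ℝ ∞ f) =>
    (contDiff_const (c := c)).smul hf

/-- `C^∞(ℝᴺ)`, as a type that carries the topology of uniform convergence of all derivatives on
compact sets. -/
def SmoothFun (N : ℕ) : Type := smoothCarrier N

instance (N : ℕ) : AddCommGroup (SmoothFun N) := inferInstanceAs (AddCommGroup (smoothCarrier N))

instance (N : ℕ) : Module ℂ (SmoothFun N) := inferInstanceAs (Module ℂ (smoothCarrier N))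

instance (N : ℕ) : CoeFun (SmoothFun N) (fun _ => (Fin N → ℝ) → ℂ) := ⟨fun f => Subtype.val f⟩

theorem SmoothFun.contDiff {N : ℕ} (f : SmoothFun N) : ContDiff ℝ ∞ (f : (Fin N → ℝ) → ℂ) := f.2

theorem smooth_bddAbove {N : ℕ} (f : SmoothFun N) (K : TopologicalSpace.Compacts (Fin N → ℝ))
    (l : ℕ) : BddAbove (Set.range fun x : K => ‖iteratedFDeriv ℝ l f x‖) := by
  have hf := f.contDiff
  have hc : Continuous fun x => ‖iteratedFDeriv ℝ l f x‖ :=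
    (hf.continuous_iteratedFDeriv (by exact_mod_cast le_top)).norm
  have h := K.isCompact.bddAbove_image hc.continuousOn
  rwa [Set.image_eq_range] at h

/-- The seminorm `f ↦ sup_{x ∈ K} ‖D^l f (x)‖` for a compact set `K`. -/
def smoothSeminorm (N : ℕ) (K : TopologicalSpace.Compacts (Fin N → ℝ)) (l : ℕ) :
    Seminorm ℂ (SmoothFun N) :=
  Seminorm.of (fun f => ⨆ x : K, ‖iteratedFDeriv ℝ l f x‖)
    (by
      intro f g
      have h0 : 0 ≤ (⨆ x : K, ‖iteratedFDeriv ℝ l f x‖) + ⨆ x : K, ‖iteratedFDeriv ℝ l g x‖ :=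
        add_nonneg (Real.iSup_nonneg fun _ => norm_nonneg _)
          (Real.iSup_nonneg fun _ => norm_nonneg _)
      refine Real.iSup_le (fun x => ?_) h0
      have hf : ContDiff ℝ l (f : (Fin N → ℝ) → ℂ) :=
        f.contDiff.of_le (by exact_mod_cast le_top)
      have hg : ContDiff ℝ l (g : (Fin N → ℝ) → ℂ) :=
        g.contDiff.of_le (by exact_mod_cast le_top)
      have h3 : iteratedFDeriv ℝ l (f + g : SmoothFun N) x =
          iteratedFDeriv ℝ l f x + iteratedFDeriv ℝ l g x :=
        iteratedFDeriv_add_apply hf.contDiffAt hg.contDiffAt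
      rw [h3]
      exact (norm_add_le _ _).trans
        (add_le_add (le_ciSup (smooth_bddAbove f K l) x) (le_ciSup (smooth_bddAbove g K l) x)))
    (by
      intro c f
      rw [Real.mul_iSup_of_nonneg (norm_nonneg c)]
      congr 1
      ext x
      have hf : ContDiff ℝ l (f : (Fin N → ℝ) → ℂ) :=
        f.contDiff.of_le (by exact_mod_cast le_top)
      have h3 : iteratedFDeriv ℝ l (c • f : SmoothFun N) x = c • iteratedFDeriv ℝ l f x :=
        iteratedFDeriv_const_smul_apply hf.contDiffAt
      rw [h3, norm_smul])

/-- The seminorms of `C^∞(ℝᴺ)`. -/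
def smoothFamily (N : ℕ) :
    SeminormFamily ℂ (SmoothFun N) (TopologicalSpace.Compacts (Fin N → ℝ) × ℕ) :=
  fun i => smoothSeminorm N i.1 i.2

instance (N : ℕ) : TopologicalSpace (SmoothFun N) :=
  (smoothFamily N).moduleFilterBasis.topology

/-! ### The natural map -/

/-- `Φ` is the natural map `𝓕_k⁽ⁿ⁾ → C^∞(ℝⁿ⁺¹)`: it sends the class of an elementary tensor
`f₀ ⊗ ⋯ ⊗ f_n` to the function `(x₀, …, x_n) ↦ f₀(x₀) ⋯ f_n(x_n)`. -/
def IsNaturalMap {n : ℕ} {k : Fin (n + 1)} (Φ : FLim n k →L[ℂ] SmoothFun (n + 1)) : Prop :=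
  ∀ (m : MultiIndex n k) (f : ∀ j, (factor k m j).Elem) (x : Fin (n + 1) → ℝ),
    Φ (FLim.of k m (elemTensor f)) x = ∏ j, f j (x j)

/-- The subspace `𝓕⁽ⁿ⁾ = ∑_k 𝓕_k⁽ⁿ⁾` of `C^∞(ℝⁿ⁺¹)`: the sum over `k` of the images of the
natural maps. -/
def FSum (n : ℕ) : Submodule ℂ (SmoothFun (n + 1)) :=
  ⨆ (k : Fin (n + 1)) (Φ : FLim n k →L[ℂ] SmoothFun (n + 1)) (_ : IsNaturalMap Φ),
    LinearMap.range Φ.toLinearMap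

end TensorSymbol

end

/-! Existence and uniqueness are formal. By the Leibniz rule the multilinear product map into
`SmoothFun` is bounded by products of continuous seminorms, so it extends to the completed
projective tensor product because the target is complete and Hausdorff; the extensions are
compatible with the transition maps. Elementary tensors span a dense subspace of each step, which
forces uniqueness.

The content is injectivity. It suffices that an element `t` of a step with natural image zero dies
in the step where every index is raised by one; injectivity of the individual steps is not needed.
The transition map is the tensor product of the inclusions of the factors, and these are
approximated by operators that see a function only through integrals against continuous compactly
supported kernels.

If every factor carries a finite sum of rank one maps with such functionals, Fubini's theorem shows
that their tensor product is a finite sum of maps `z ↦ Λ(natural z) • e`, with `Λ` integration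
against a product kernel. Hence it kills the kernel of the natural map
(`completion_map_finiteRank_eq_zero`). This property survives equicontinuous pointwise limits
(`completion_map_eq_zero`): the supremum of the pulled-back seminorms is a continuous seminorm for
the projective topology.

The inclusion of a factor is reached by two successive limits. Multiplication by a cutoff of scale
`T` is expanded in a Fourier series whose coefficients are integral functionals
(`hasExpansion_cutoffMul`); as `T` tends to infinity the cutoffs tend to the inclusion
(`tendsto_cutoffMul`). The bounds on the partial sums depend on `T`, whence two limits instead of
one. `WeightedPair` isolates what is used: the larger space has weights weaker by a factor `1 +
|x|`. For symbols this comes from raising the order by one; for Gaussian decay from shrinking the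
exponent, after one-dimensional Sobolev estimates pass between weighted `L²` norms and weighted
suprema (`norm_weightedDeriv_le`, `decaySeminorm_le`). -/

noncomputable section

namespace TensorSymbol

open Filter Topology

/-! ### Continuous seminorms of function spaces -/

/-- A neighbourhood of zero contains the open unit ball of a continuous seminorm. -/
theorem exists_seminorm_of_mem_nhds {E κ : Type*} [AddCommGroup E] [Module ℂ E]
    [TopologicalSpace E] [Nonempty κ] {P : SeminormFamily ℂ E κ} (hP : WithSeminorms P)
    {t : Set E} (ht : t ∈ 𝓝 0) :
    ∃ s : Seminorm ℂ E, Continuous s ∧ ∀ f, s f < 1 → f ∈ t := by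
  have := hP.topologicalAddGroup
  obtain ⟨u, r, hr, hu⟩ := (hP.mem_nhds_iff 0 t).1 ht
  let c : NNReal := ⟨r⁻¹, (inv_pos.2 hr).le⟩
  have hc : Continuous ⇑(u.sup P : Seminorm ℂ E) :=
    Seminorm.continuous_of_le (q := ∑ j ∈ u, P j)
      (by
        have h1 : ⇑(∑ j ∈ u, P j) = fun f => ∑ j ∈ u, P j f := by
          ext f
          rw [sum_apply]
        rw [h1]
        exact continuous_finsetSum _ fun j _ => hP.continuous_seminorm j)
      (Seminorm.finset_sup_le_sum P u)
  refine ⟨c • (u.sup P : Seminorm ℂ E), hc.const_smul c, fun f hf => hu ?_⟩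
  rw [Seminorm.mem_ball_zero]
  rw [smul_apply] at hf
  have h2 : r⁻¹ * (u.sup P) f < 1 := hf
  rwa [inv_mul_lt_iff₀ hr, mul_one] at h2

namespace FunctionSpace

instance (X : FunctionSpace) : IsTopologicalAddGroup X.Elem := X.withSeminorms.topologicalAddGroup

instance (X : FunctionSpace) : ContinuousSMul ℂ X.Elem := X.withSeminorms.continuousSMul

theorem continuous_family (X : FunctionSpace) (i : ℕ) : Continuous (X.family i) :=
  X.withSeminorms.continuous_seminorm i

/-- A linear map between function spaces each of whose seminorms is dominated by a continuous
seminorm is continuous. -/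
theorem continuous_of_bound {X Y : FunctionSpace} (T : X.Elem →ₗ[ℂ] Y.Elem)
    (h : ∀ j, ∃ s : Seminorm ℂ X.Elem, Continuous s ∧ ∀ f, Y.family j (T f) ≤ s f) :
    Continuous T := by
  refine Y.withSeminorms.continuous_of_continuous_comp T fun j => ?_
  obtain ⟨s, hs, hb⟩ := h j
  exact Seminorm.continuous_of_le hs hb

/-- A family of maps into a function space that is equicontinuous for the defining seminorms is
equicontinuous for all continuous seminorms. -/
theorem exists_bound_of_equicontinuous {X Y : FunctionSpace} {ν : Type*}
    (T : ν → X.Elem → Y.Elem)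
    (h : ∀ j, ∃ s : Seminorm ℂ X.Elem, Continuous s ∧ ∀ a f, Y.family j (T a f) ≤ s f)
    (p : Seminorm ℂ Y.Elem) (hp : Continuous p) :
    ∃ s : Seminorm ℂ X.Elem, Continuous s ∧ ∀ a f, p (T a f) ≤ s f := by
  obtain ⟨t, C, -, hC⟩ := Seminorm.bound_of_continuous Y.withSeminorms p hp
  choose s hs hb using h
  refine ⟨C • ∑ j ∈ t, s j, ?_, fun a f => ?_⟩
  · have h1 : ⇑(C • ∑ j ∈ t, s j) = fun f => C • ∑ j ∈ t, s j f := by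
      ext f
      rw [smul_apply, sum_apply]
    rw [h1]
    exact (continuous_finsetSum _ fun j _ => hs j).const_smul C
  · refine (hC _).trans ?_
    rw [smul_apply, smul_apply]
    refine smul_le_smul_of_nonneg_left ?_ zero_le
    refine (Seminorm.finset_sup_le_sum Y.family t _).trans ?_
    rw [sum_apply, sum_apply]
    exact Finset.sum_le_sum fun j _ => hb j a f

end FunctionSpace

/-! ### Multilinear maps and products of seminorms -/

section Multilinear

variable {ι : Type} [Fintype ι] {X : ι → FunctionSpace} {G : Type*} [AddCommGroup G] [Module ℂ G]

/-- A seminorm that is continuous along a multilinear map is bounded there by a product of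
continuous seminorms. -/
theorem exists_prod_bound [Nonempty ι] (M : MultilinearMap ℂ (fun i => (X i).Elem) G)
    (q : Seminorm ℂ G) (hq : Continuous fun x => q (M x)) :
    ∃ s : ∀ i, Seminorm ℂ (X i).Elem, (∀ i, Continuous (s i)) ∧
      ∀ x, q (M x) ≤ ∏ i, s i (x i) := by
  have h0 : {x | q (M x) < 1} ∈ 𝓝 (0 : ∀ i, (X i).Elem) := by
    refine (isOpen_lt hq continuous_const).mem_nhds ?_
    simp
  rw [nhds_pi, Filter.mem_pi] at h0
  obtain ⟨I, -, t, ht, hI⟩ := h0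
  choose s hs hst using fun i =>
    exists_seminorm_of_mem_nhds (X i).withSeminorms (ht i)
  refine ⟨s, hs, fun x => ?_⟩
  -- The seminorms may vanish on `x i`, so a positive `δ` is added before rescaling each vector into
  -- the unit ball; it is removed by a limit at the end.
  have hδ : ∀ δ : ℝ, 0 < δ → q (M x) ≤ ∏ i, (s i (x i) + δ) := by
    intro δ hδ
    have hpos : ∀ i, 0 < s i (x i) + δ := fun i => by
      have := apply_nonneg (s i) (x i)
      linarith
    have h1 : q (M fun i => (((s i (x i) + δ)⁻¹ : ℝ) : ℂ) • x i) < 1 := by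
      refine hI fun i _ => hst i _ ?_
      rw [map_smul_eq_mul, Complex.norm_real, Real.norm_of_nonneg (inv_pos.2 (hpos i)).le,
        inv_mul_lt_iff₀ (hpos i)]
      linarith
    rw [M.map_smul_univ, map_smul_eq_mul, norm_prod] at h1
    have h2 : ∏ i, ‖(((s i (x i) + δ)⁻¹ : ℝ) : ℂ)‖ = (∏ i, (s i (x i) + δ))⁻¹ := by
      rw [← Finset.prod_inv_distrib]
      refine Finset.prod_congr rfl fun i _ => ?_
      rw [Complex.norm_real, Real.norm_of_nonneg (inv_pos.2 (hpos i)).le]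
    rw [h2, inv_mul_lt_iff₀ (Finset.prod_pos fun i _ => hpos i), mul_one] at h1
    exact h1.le
  have hc : Continuous fun δ : ℝ => ∏ i, (s i (x i) + δ) := by fun_prop
  have hlim : Tendsto (fun δ : ℝ => ∏ i, (s i (x i) + δ)) (𝓝[>] 0) (𝓝 (∏ i, s i (x i))) := by
    have := (hc.tendsto 0).mono_left (nhdsWithin_le_nhds (s := Set.Ioi (0 : ℝ)))
    simpa using this
  exact ge_of_tendsto hlim (eventually_nhdsWithin_of_forall fun δ h => hδ δ h)

/-- A multilinear map that is bounded by a product of continuous seminorms is continuous, for the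
seminorm on the target. -/
theorem tendsto_of_prod_bound (M : MultilinearMap ℂ (fun i => (X i).Elem) G)
    (q : Seminorm ℂ G) {C : ℝ} {s : ∀ i, Seminorm ℂ (X i).Elem} (hs : ∀ i, Continuous (s i))
    (hb : ∀ x, q (M x) ≤ C * ∏ i, s i (x i)) (y : ∀ i, (X i).Elem) :
    Tendsto (fun x => q (M x - M y)) (𝓝 y) (𝓝 0) := by
  classical
  -- Expanding `M (y + (x - y))` over subsets, the empty subset gives `M y`; every other term has a
  -- factor `s i (x i - y i)`, which tends to zero.
  let B : (∀ i, (X i).Elem) → ℝ := fun x =>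
    ∑ t ∈ (Finset.univ : Finset (Finset ι)).erase ∅,
      C * ∏ i, s i (t.piecewise (x - y) y i)
  have hB : Tendsto B (𝓝 y) (𝓝 0) := by
    have hcont : Continuous B := by
      refine continuous_finsetSum _ fun t _ => continuous_const.mul
        (continuous_finsetProd _ fun i _ => (hs i).comp ?_)
      by_cases hi : i ∈ t
      · simp only [Finset.piecewise_eq_of_mem _ _ _ hi]
        exact (continuous_apply i).comp (continuous_id.sub continuous_const)
      · simp only [Finset.piecewise_eq_of_notMem _ _ _ hi]
        exact continuous_const
    have h0 : B y = 0 := by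
      refine Finset.sum_eq_zero fun t ht => ?_
      obtain ⟨i, hi⟩ := Finset.nonempty_iff_ne_empty.2 (Finset.ne_of_mem_erase ht)
      rw [Finset.prod_eq_zero (Finset.mem_univ i), mul_zero]
      rw [Finset.piecewise_eq_of_mem _ _ _ hi]
      simp
    simpa [h0] using hcont.tendsto y
  refine squeeze_zero (fun x => apply_nonneg q _) (fun x => ?_) hB
  have h1 : M x = ∑ t : Finset ι, M (t.piecewise (x - y) y) := by
    rw [← M.map_add_univ, sub_add_cancel]
  have h2 : M x - M y = ∑ t ∈ (Finset.univ : Finset (Finset ι)).erase ∅,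
      M (t.piecewise (x - y) y) := by
    rw [h1, ← Finset.add_sum_erase _ _ (Finset.mem_univ (∅ : Finset ι))]
    simp
  rw [h2]
  exact (Finset.le_sum_of_subadditive q (map_zero q).le (map_add_le_add q) _ _).trans
    (Finset.sum_le_sum fun t _ => hb _)

theorem continuous_of_prod_bound (M : MultilinearMap ℂ (fun i => (X i).Elem) G)
    (q : Seminorm ℂ G) {C : ℝ} {s : ∀ i, Seminorm ℂ (X i).Elem} (hs : ∀ i, Continuous (s i))
    (hb : ∀ x, q (M x) ≤ C * ∏ i, s i (x i)) : Continuous fun x => q (M x) := by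
  rw [continuous_iff_continuousAt]
  intro y
  rw [ContinuousAt, tendsto_iff_dist_tendsto_zero]
  refine squeeze_zero (fun _ => dist_nonneg) (fun x => ?_) (tendsto_of_prod_bound M q hs hb y)
  rw [Real.dist_eq]
  exact abs_sub_map_le_sub q _ _

end Multilinear

/-! ### Seminorms on completions -/

section Completion

open UniformSpace

variable {V : Type*} [AddCommGroup V] [Module ℂ V] [UniformSpace V]

/-- The extension of a continuous seminorm to the completion. -/
def complExt (p : Seminorm ℂ V) : Completion V → ℝ := Completion.extension p

theorem continuous_complExt (p : Seminorm ℂ V) : Continuous (complExt p) :=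
  Completion.continuous_extension

variable [IsUniformAddGroup V]

theorem uniformContinuous_of_continuous {p : Seminorm ℂ V} (hp : Continuous p) :
    UniformContinuous p :=
  Seminorm.uniformContinuous_of_continuousAt_zero hp.continuousAt

theorem complExt_coe {p : Seminorm ℂ V} (hp : Continuous p) (v : V) :
    complExt p (v : Completion V) = p v :=
  Completion.extension_coe (uniformContinuous_of_continuous hp) v

theorem complExt_add_le {p : Seminorm ℂ V} (hp : Continuous p) (z w : Completion V) :
    complExt p (z + w) ≤ complExt p z + complExt p w := by
  have hc := continuous_complExt p
  refine Completion.induction_on₂ z w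
    (isClosed_le (hc.comp continuous_add) ((hc.comp continuous_fst).add (hc.comp continuous_snd)))
    fun a b => ?_
  rw [← Completion.coe_add]
  simp only [complExt_coe hp]
  exact map_add_le_add p a b

/-- An element of the completion at which the extensions of all continuous seminorms vanish is
zero. -/
theorem eq_zero_of_complExt_eq_zero {κ : Type*} [Nonempty κ] {P : SeminormFamily ℂ V κ}
    (hP : WithSeminorms P) {z : Completion V}
    (hz : ∀ p : Seminorm ℂ V, Continuous p → complExt p z ≤ 0) : z = 0 := by
  by_contra hne
  obtain ⟨t, ht, htc, htz⟩ : ∃ t ∈ 𝓝 (0 : Completion V), IsClosed t ∧ z ∉ t := by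
    obtain ⟨t, ⟨ht, htc⟩, hts⟩ := (closed_nhds_basis (0 : Completion V)).mem_iff.1
      (isOpen_compl_singleton.mem_nhds (show (0 : Completion V) ∈ ({z} : Set _)ᶜ from
        fun h => hne (Set.mem_singleton_iff.1 h).symm))
    exact ⟨t, ht, htc, fun h => hts h rfl⟩
  have ht' : ((↑) : V → Completion V) ⁻¹' t ∈ 𝓝 (0 : V) :=
    (Completion.continuous_coe V).continuousAt.preimage_mem_nhds (by rwa [Completion.coe_zero])
  obtain ⟨s, hs, hst⟩ := exists_seminorm_of_mem_nhds hP ht'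
  have hU : IsOpen {w | complExt s w < 1} := isOpen_lt (continuous_complExt s) continuous_const
  have hzU : z ∈ {w | complExt s w < 1} := lt_of_le_of_lt (hz s hs) one_pos
  -- By density `z` is a limit of points of `V` on which `s` is less than one. All of these lie in
  -- the closed set `t`, hence so does `z`.
  refine htz (htc.closure_subset_iff.2 ?_
    (Completion.denseRange_coe.open_subset_closure_inter hU hzU))
  rintro _ ⟨hv, v, rfl⟩
  refine hst v ?_
  rwa [Set.mem_ofPred_eq, complExt_coe hs] at hv

end Completion

/-! ### Nets of maps of projective tensor products -/

section Projective

variable {ι : Type}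

theorem ProjTensor.induction {E : ι → Type} [∀ i, AddCommGroup (E i)] [∀ i, Module ℂ (E i)]
    {P : ProjTensor E → Prop} (v : ProjTensor E)
    (smul_tprod : ∀ (c : ℂ) (x : ∀ i, E i), P (c • ProjTensor.tprod E x))
    (add : ∀ v w, P v → P w → P (v + w)) : P v :=
  PiTensorProduct.induction_on (motive := P) v smul_tprod add

variable [Fintype ι] {X Y : ι → FunctionSpace}

/-- The defining seminorms are only required to be continuous along `tprod`. Continuity of `tprod`
itself needs control of differences, which the product bounds supply. -/
theorem continuous_tprod [Nonempty ι] : Continuous (ProjTensor.tprod fun i => (X i).Elem) := by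
  rw [continuous_iff_continuousAt]
  intro y
  rw [ContinuousAt, (projTensor_withSeminorms fun i => (X i).Elem).tendsto_nhds]
  intro p ε hε
  obtain ⟨s, hs, hb⟩ := exists_prod_bound (ProjTensor.tprod fun i => (X i).Elem) p.1 p.2
  exact (tendsto_of_prod_bound _ p.1 (C := 1) hs (by simpa using hb) y).eventually_lt_const hε

/-- A seminorm that is bounded on elementary tensors by products of continuous seminorms is
continuous. -/
theorem continuous_of_tprod_bound (q : Seminorm ℂ (ProjTensor fun i => (X i).Elem)) {C : ℝ}
    {s : ∀ i, Seminorm ℂ (X i).Elem} (hs : ∀ i, Continuous (s i))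
    (hb : ∀ x, q (ProjTensor.tprod _ x) ≤ C * ∏ i, s i (x i)) : Continuous q :=
  (projTensor_withSeminorms fun i => (X i).Elem).continuous_seminorm
    ⟨q, continuous_of_prod_bound _ q hs hb⟩

variable [Nonempty ι] {ν : Type*}

/-- Let `T` be an equicontinuous net of tuples of maps that converges pointwise to `A`. If every
`⨂ T_a` kills an element of the completed projective tensor product, then so does `⨂ A`. -/
theorem completion_map_eq_zero (l : Filter ν) [l.NeBot]
    (T : ν → ∀ i, (X i).Elem →L[ℂ] (Y i).Elem) (A : ∀ i, (X i).Elem →L[ℂ] (Y i).Elem)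
    (hT : ∀ i j, ∃ s : Seminorm ℂ (X i).Elem, Continuous s ∧
      ∀ a f, (Y i).family j (T a i f) ≤ s f)
    (hA : ∀ i f, Tendsto (fun a => T a i f) l (𝓝 (A i f)))
    (u : ComplTensor fun i => (X i).Elem)
    (hu : ∀ a, (ProjTensor.map (T a)).completion u = 0) :
    (ProjTensor.map A).completion u = 0 := by
  have hlim : ∀ v, Tendsto (fun a => ProjTensor.map (T a) v) l (𝓝 (ProjTensor.map A v)) := by
    intro v
    induction v using ProjTensor.induction with
    | smul_tprod c x =>
      simp only [map_smul]
      refine Tendsto.const_smul ?_ c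
      have h1 := ((continuous_tprod (X := Y)).tendsto fun i => A i (x i)).comp
        (tendsto_pi_nhds.2 fun i => hA i (x i))
      have h2 : ∀ S : ∀ i, (X i).Elem →L[ℂ] (Y i).Elem,
          ProjTensor.map S (ProjTensor.tprod _ x) = ProjTensor.tprod _ fun i => S i (x i) :=
        fun S => ProjTensor.mapLinear_tprod S x
      simpa only [h2, Function.comp_def] using h1
    | add v w hv hw => simpa only [map_add] using hv.add hw
  refine eq_zero_of_complExt_eq_zero (projTensor_withSeminorms fun i => (Y i).Elem) fun p hp => ?_
  obtain ⟨s, hs, hb⟩ := exists_prod_bound (ProjTensor.tprod fun i => (Y i).Elem) p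
    (hp.comp continuous_tprod)
  choose s' hs' hb' using fun i =>
    FunctionSpace.exists_bound_of_equicontinuous (fun a => T a i) (hT i) (s i) (hs i)
  have hb2 : ∀ a x, p (ProjTensor.map (T a) (ProjTensor.tprod _ x)) ≤ ∏ i, s' i (x i) := by
    intro a x
    have h2 : ProjTensor.map (T a) (ProjTensor.tprod _ x) = ProjTensor.tprod _ fun i => T a i (x i) :=
      ProjTensor.mapLinear_tprod _ x
    rw [h2]
    exact (hb _).trans (Finset.prod_le_prod (fun i _ => apply_nonneg _ _) fun i _ => hb' i a (x i))
  -- Pointwise boundedness makes the supremum `q` a seminorm. On elementary tensors it is at most `∏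
  -- i, s' i (x i)`, so it is continuous and controls the whole net at once.
  have hbdd : BddAbove (Set.range fun a => p.comp (ProjTensor.map (T a)).toLinearMap) := by
    rw [Seminorm.bddAbove_range_iff]
    intro v
    induction v using ProjTensor.induction with
    | smul_tprod c x =>
      refine ⟨‖c‖ * ∏ i, s' i (x i), ?_⟩
      rintro _ ⟨a, rfl⟩
      simp only [map_smul_eq_mul]
      exact mul_le_mul_of_nonneg_left (hb2 a x) (norm_nonneg c)
    | add v w hv hw =>
      obtain ⟨B, hB⟩ := hv
      obtain ⟨C, hC⟩ := hw
      refine ⟨B + C, ?_⟩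
      rintro _ ⟨a, rfl⟩
      exact (map_add_le_add _ _ _).trans (add_le_add (hB ⟨a, rfl⟩) (hC ⟨a, rfl⟩))
  set q : Seminorm ℂ (ProjTensor fun i => (X i).Elem) :=
    ⨆ a, p.comp (ProjTensor.map (T a)).toLinearMap with hq
  have hqle : ∀ a v, p (ProjTensor.map (T a) v) ≤ q v := fun a v =>
    le_ciSup hbdd a v
  have : Nonempty ν := l.nonempty_of_neBot
  have hqc : Continuous q := by
    refine continuous_of_tprod_bound q (C := 1) hs' fun x => ?_
    rw [one_mul, hq, Seminorm.iSup_apply hbdd]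
    exact ciSup_le fun a => hb2 a x
  have hAle : ∀ v, p (ProjTensor.map A v) ≤ q v := fun v =>
    le_of_tendsto ((hp.tendsto _).comp (hlim v)) (Eventually.of_forall fun a => hqle a v)
  have ext_le : ∀ S : (ProjTensor fun i => (X i).Elem) →L[ℂ] ProjTensor fun i => (Y i).Elem,
      (∀ v, p (S v) ≤ q v) → ∀ z, complExt p (S.completion z) ≤ complExt q z := by
    intro S hS z
    refine UniformSpace.Completion.induction_on z (isClosed_le
      ((continuous_complExt p).comp S.completion.continuous) (continuous_complExt q)) fun v => ?_
    rw [ContinuousLinearMap.completion_apply_coe, complExt_coe hp, complExt_coe hqc]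
    exact hS v
  refine le_of_forall_pos_le_add fun ε hε => ?_
  -- Both differences occur because evenness of `complExt q` is not established: `v - u` serves the
  -- maps `T a`, and `u - v` serves `A`.
  have hopen : IsOpen {z | complExt q (u - z) < ε / 2 ∧ complExt q (z - u) < ε / 2} := by
    have hc := continuous_complExt q
    exact (isOpen_lt (hc.comp (continuous_const.sub continuous_id)) continuous_const).inter
      (isOpen_lt (hc.comp (continuous_id.sub continuous_const)) continuous_const)
  have hmem : u ∈ {z | complExt q (u - z) < ε / 2 ∧ complExt q (z - u) < ε / 2} := by
    have h0 : complExt q 0 = 0 := by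
      rw [← UniformSpace.Completion.coe_zero, complExt_coe hqc, map_zero]
    simp only [Set.mem_ofPred_eq, sub_self, h0]
    constructor <;> linarith
  obtain ⟨v, hv1, hv2⟩ := UniformSpace.Completion.denseRange_coe.exists_mem_open hopen ⟨u, hmem⟩
  -- Since `⨂ T a` kills `u`, its value at `v` is its value at `v - u`, which is small uniformly in
  -- `a`.
  have hTv : ∀ a, p (ProjTensor.map (T a) v) ≤ ε / 2 := by
    intro a
    have h1 := ext_le _ (hqle a) ((v : ComplTensor fun i => (X i).Elem) - u)
    rw [map_sub, hu a, sub_zero, ContinuousLinearMap.completion_apply_coe, complExt_coe hp] at h1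
    exact h1.trans hv2.le
  have hAv : p (ProjTensor.map A v) ≤ ε / 2 :=
    le_of_tendsto ((hp.tendsto _).comp (hlim v)) (Eventually.of_forall hTv)
  have h2 := ext_le _ hAle (u - v)
  have h3 := complExt_add_le hp ((ProjTensor.map A).completion (u - v))
    ((ProjTensor.map A).completion v)
  rw [← map_add, sub_add_cancel, ContinuousLinearMap.completion_apply_coe _ v,
    complExt_coe hp] at h3
  linarith

end Projective

/-! ### Completeness of `C^∞(ℝᴺ)` -/

section Smooth

variable {N : ℕ}

theorem smoothFun_withSeminorms (N : ℕ) : WithSeminorms (smoothFamily N) := ⟨rfl⟩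

instance : IsTopologicalAddGroup (SmoothFun N) := (smoothFun_withSeminorms N).topologicalAddGroup

instance : ContinuousSMul ℂ (SmoothFun N) := (smoothFun_withSeminorms N).continuousSMul

instance : UniformSpace (SmoothFun N) := IsTopologicalAddGroup.rightUniformSpace (SmoothFun N)

instance : IsUniformAddGroup (SmoothFun N) := isUniformAddGroup_of_addCommGroup

theorem smoothSeminorm_continuous (K : TopologicalSpace.Compacts (Fin N → ℝ)) (l : ℕ) :
    Continuous (smoothSeminorm N K l) :=
  (smoothFun_withSeminorms N).continuous_seminorm (K, l)

theorem norm_iteratedFDeriv_le_smoothSeminorm (K : TopologicalSpace.Compacts (Fin N → ℝ)) (l : ℕ)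
    (f : SmoothFun N) {x : Fin N → ℝ} (hx : x ∈ K) :
    ‖iteratedFDeriv ℝ l f x‖ ≤ smoothSeminorm N K l f :=
  le_ciSup (smooth_bddAbove f K l) ⟨x, hx⟩

theorem smoothSeminorm_le {K : TopologicalSpace.Compacts (Fin N → ℝ)} {l : ℕ} {f : SmoothFun N}
    {B : ℝ} (hB : 0 ≤ B) (h : ∀ x ∈ K, ‖iteratedFDeriv ℝ l f x‖ ≤ B) :
    smoothSeminorm N K l f ≤ B :=
  Real.iSup_le (fun x : K => h x x.2) hB

theorem norm_le_smoothSeminorm (K : TopologicalSpace.Compacts (Fin N → ℝ)) (f : SmoothFun N)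
    {x : Fin N → ℝ} (hx : x ∈ K) : ‖f x‖ ≤ smoothSeminorm N K 0 f := by
  simpa using norm_iteratedFDeriv_le_smoothSeminorm K 0 f hx

theorem SmoothFun.ext {f g : SmoothFun N} (h : ∀ x, f x = g x) : f = g :=
  Subtype.ext (funext h)

theorem iteratedFDeriv_smoothFun_sub (f g : SmoothFun N) (l : ℕ) (x : Fin N → ℝ) :
    iteratedFDeriv ℝ l (f - g : SmoothFun N) x =
      iteratedFDeriv ℝ l f x - iteratedFDeriv ℝ l g x := by
  have hf : ContDiff ℝ l (f : (Fin N → ℝ) → ℂ) := f.contDiff.of_le (by exact_mod_cast le_top)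
  have hg : ContDiff ℝ l (g : (Fin N → ℝ) → ℂ) := g.contDiff.of_le (by exact_mod_cast le_top)
  exact iteratedFDeriv_sub_apply hf.contDiffAt hg.contDiffAt

instance : T2Space (SmoothFun N) := by
  have : T1Space (SmoothFun N) := by
    refine (smoothFun_withSeminorms N).T1_of_separating fun f hf => ?_
    by_contra! h
    refine hf (SmoothFun.ext fun x => norm_le_zero_iff.1 ?_)
    have h1 := norm_le_smoothSeminorm ⟨{x}, isCompact_singleton⟩ f (Set.mem_singleton x)
    exact h1.trans (h (⟨{x}, isCompact_singleton⟩, 0)).le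
  infer_instance

theorem uniformCauchySeqOn_iteratedFDeriv {F : Filter (SmoothFun N)} (hF : Cauchy F)
    (l : ℕ) {K : Set (Fin N → ℝ)} (hK : IsCompact K) :
    UniformCauchySeqOn (fun (f : SmoothFun N) x => iteratedFDeriv ℝ l f x) F K := by
  intro u hu
  obtain ⟨ε, hε, hεu⟩ := Metric.mem_uniformity_dist.1 hu
  have h1 : Tendsto (fun p : SmoothFun N × SmoothFun N => p.2 - p.1) (F ×ˢ F) (𝓝 0) := by
    have h2 := hF.2
    rw [uniformity_eq_comap_nhds_zero, ← tendsto_iff_comap] at h2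
    exact h2
  have h3 := ((smoothFun_withSeminorms N).tendsto_nhds _ _).1 h1 (⟨K, hK⟩, l) ε hε
  filter_upwards [h3] with p hp x hx
  refine hεu ?_
  rw [dist_comm, dist_eq_norm, ← iteratedFDeriv_smoothFun_sub]
  rw [sub_zero] at hp
  exact (norm_iteratedFDeriv_le_smoothSeminorm ⟨K, hK⟩ l _ hx).trans_lt hp

/-- Along a Cauchy filter the derivatives of each order converge locally uniformly, and
differentiation commutes with such limits, so the limits form the Taylor series of a smooth
function. Completeness is what allows the natural map to extend to the completion. -/
instance : CompleteSpace (SmoothFun N) := by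
  refine ⟨fun {F} hF => ?_⟩
  have := hF.1
  have hpt : ∀ (l : ℕ) (x : Fin N → ℝ), ∃ y,
      Tendsto (fun f : SmoothFun N => iteratedFDeriv ℝ l f x) F (𝓝 y) := fun l x =>
    CompleteSpace.complete
      ((uniformCauchySeqOn_iteratedFDeriv hF l isCompact_singleton).cauchy_map (Set.mem_singleton x))
  choose g hg using hpt
  have hunif : ∀ (l : ℕ) {K : Set (Fin N → ℝ)}, IsCompact K →
      TendstoUniformlyOn (fun (f : SmoothFun N) x => iteratedFDeriv ℝ l f x) (g l) F K :=
    fun l K hK => (uniformCauchySeqOn_iteratedFDeriv hF l hK).tendstoUniformlyOn_of_tendsto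
      fun x _ => hg l x
  have hloc : ∀ l : ℕ, TendstoLocallyUniformlyOn
      (fun (f : SmoothFun N) x => iteratedFDeriv ℝ l f x) (g l) F Set.univ := fun l =>
    (tendstoLocallyUniformlyOn_iff_forall_isCompact isOpen_univ).2 fun K _ hK => hunif l hK
  have hT : HasFTaylorSeriesUpTo ∞ (fun x => (g 0 x).curry0) (fun x l => g l x) := by
    refine ⟨fun x => rfl, fun l _ x => ?_, fun l _ => ?_⟩
    · have hu := (continuousMultilinearCurryLeftEquiv ℝ (fun _ : Fin (l + 1) => Fin N → ℝ)
        ℂ).lipschitz.uniformContinuous.comp_tendstoLocallyUniformlyOn (hloc (l + 1))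
      refine hasFDerivAt_of_tendstoLocallyUniformlyOn (x := x) isOpen_univ hu (fun f z _ => ?_)
        (fun z _ => hg l z) (Set.mem_univ x)
      exact (contDiff_iff_ftaylorSeries.1 f.contDiff).fderiv l (by exact_mod_cast WithTop.coe_lt_top l) z
    · refine (tendstoLocallyUniformlyOn_univ.1 (hloc l)).continuous
        (Frequently.of_forall fun f => ?_)
      exact f.contDiff.continuous_iteratedFDeriv (by exact_mod_cast le_top)
  let f₀ : SmoothFun N := ⟨fun x => (g 0 x).curry0, hT.contDiff⟩
  have hf₀ : ∀ l x, iteratedFDeriv ℝ l f₀ x = g l x := fun l x =>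
    (hT.eq_iteratedFDeriv (by exact_mod_cast le_top) x).symm
  refine ⟨f₀, ?_⟩
  have h := ((smoothFun_withSeminorms N).tendsto_nhds id (f := F) f₀).2 ?_
  · exact h
  rintro ⟨K, l⟩ ε hε
  filter_upwards [Metric.tendstoUniformlyOn_iff.1 (hunif l K.isCompact) (ε / 2) (half_pos hε)]
    with f hf
  refine lt_of_le_of_lt (smoothSeminorm_le (half_pos hε).le fun x hx => ?_) (half_lt_self hε)
  rw [id, iteratedFDeriv_smoothFun_sub, hf₀, ← dist_eq_norm, dist_comm]
  exact (hf x hx).le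

end Smooth

/-- The elements of `X` are smooth, and on bounded sets their derivatives are controlled by
continuous seminorms. -/
structure FunctionSpace.EmbedsSmooth (X : FunctionSpace) : Prop where
  contDiff : ∀ f : X.Elem, ContDiff ℝ ∞ (f : ℝ → ℂ)
  bound : ∀ (R : ℝ) (i : ℕ), ∃ s : Seminorm ℂ X.Elem, Continuous s ∧
    ∀ (f : X.Elem) (x : ℝ), |x| ≤ R → ‖iteratedDeriv i (f : ℝ → ℂ) x‖ ≤ s f

/-! ### The natural map on the completed tensor product -/

section Natural

variable {N : ℕ} {X : Fin N → FunctionSpace}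

/-- The multilinear map `(f_j) ↦ ((x_j) ↦ ∏ f_j(x_j))`. -/
def prodFun (hX : ∀ j, (X j).EmbedsSmooth) :
    MultilinearMap ℂ (fun j => (X j).Elem) (SmoothFun N) where
  toFun f := ⟨fun x => ∏ j, f j (x j), contDiff_prod fun j _ =>
    ((hX j).contDiff (f j)).comp (contDiff_apply ℝ ℝ j)⟩
  map_update_add' f j a b := by
    refine SmoothFun.ext fun x => ?_
    exact ((MultilinearMap.mkPiAlgebra ℂ (Fin N) ℂ).compLinearMap fun j =>
      (LinearMap.proj (x j) ∘ₗ (X j).carrier.subtype : (X j).carrier →ₗ[ℂ] ℂ)).map_update_add f j a b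
  map_update_smul' f j c a := by
    refine SmoothFun.ext fun x => ?_
    exact ((MultilinearMap.mkPiAlgebra ℂ (Fin N) ℂ).compLinearMap fun j =>
      (LinearMap.proj (x j) ∘ₗ (X j).carrier.subtype : (X j).carrier →ₗ[ℂ] ℂ)).map_update_smul f j c a

theorem prodFun_apply (hX : ∀ j, (X j).EmbedsSmooth) (f : ∀ j, (X j).Elem) (x : Fin N → ℝ) :
    prodFun hX f x = ∏ j, f j (x j) := rfl

theorem norm_iteratedFDeriv_comp_proj_le {f : ℝ → ℂ} (hf : ContDiff ℝ ∞ f) (j : Fin N) (i : ℕ)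
    (x : Fin N → ℝ) :
    ‖iteratedFDeriv ℝ i (fun y : Fin N → ℝ => f (y j)) x‖ ≤ ‖iteratedDeriv i f (x j)‖ := by
  have h := (ContinuousLinearMap.proj (R := ℝ) (φ := fun _ : Fin N => ℝ) j).iteratedFDeriv_comp_right
    hf x (i := i) (by exact_mod_cast le_top)
  have h2 : (f ∘ (ContinuousLinearMap.proj (R := ℝ) (φ := fun _ : Fin N => ℝ) j)) =
    fun y : Fin N → ℝ => f (y j) := rfl
  rw [h2] at h
  rw [h, ← norm_iteratedFDeriv_eq_norm_iteratedDeriv]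
  refine (ContinuousMultilinearMap.norm_compContinuousLinearMap_le _ _).trans ?_
  have hn : ‖ContinuousLinearMap.proj (R := ℝ) (φ := fun _ : Fin N => ℝ) j‖ ≤ 1 :=
    ContinuousLinearMap.opNorm_le_bound _ zero_le_one fun y => by
      rw [one_mul]
      exact norm_le_pi_norm y j
  exact mul_le_of_le_one_right (norm_nonneg _)
    (Finset.prod_le_one (fun _ _ => norm_nonneg _) fun _ _ => hn)

/-- By the Leibniz rule at most `l` derivatives fall on each factor, so summing the one-variable
bounds of orders `0, …, l` dominates every term. This gives continuity of the natural map. -/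
theorem smoothSeminorm_prodFun_le (hX : ∀ j, (X j).EmbedsSmooth)
    (K : TopologicalSpace.Compacts (Fin N → ℝ)) (l : ℕ) :
    ∃ (C : ℝ) (s : ∀ j, Seminorm ℂ (X j).Elem), (∀ j, Continuous (s j)) ∧
      ∀ f, smoothSeminorm N K l (prodFun hX f) ≤ C * ∏ j, s j (f j) := by
  classical
  obtain ⟨R, hR⟩ := K.isCompact.isBounded.exists_norm_le
  choose s hs hb using fun j => (hX j).bound R
  refine ⟨∑ p ∈ (Finset.univ : Finset (Fin N)).sym l, ((p : Multiset (Fin N)).countPerms : ℝ),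
    fun j => ∑ i ∈ Finset.range (l + 1), s j i, fun j => ?_, fun f => ?_⟩
  · have h1 : ⇑(∑ i ∈ Finset.range (l + 1), s j i) =
        fun f => ∑ i ∈ Finset.range (l + 1), s j i f := by
      ext f
      rw [sum_apply]
    rw [h1]
    exact continuous_finsetSum _ fun i _ => hs j i
  · have hnn : ∀ j, 0 ≤ (∑ i ∈ Finset.range (l + 1), s j i) (f j) := fun j => apply_nonneg _ _
    refine smoothSeminorm_le (mul_nonneg (Finset.sum_nonneg fun _ _ => Nat.cast_nonneg _)
      (Finset.prod_nonneg fun j _ => hnn j)) fun x hx => ?_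
    have h1 := norm_iteratedFDeriv_prod_le (𝕜 := ℝ) (N := ∞) (u := (Finset.univ : Finset (Fin N)))
      (f := fun j (y : Fin N → ℝ) => f j (y j)) (x := x) (n := l)
      (fun j _ => ((hX j).contDiff (f j)).comp (contDiff_apply ℝ ℝ j)) (by exact_mod_cast le_top)
    refine h1.trans ?_
    rw [Finset.sum_mul]
    refine Finset.sum_le_sum fun p _ => mul_le_mul_of_nonneg_left ?_ (Nat.cast_nonneg _)
    refine Finset.prod_le_prod (fun _ _ => norm_nonneg _) fun j _ => ?_
    refine (norm_iteratedFDeriv_comp_proj_le ((hX j).contDiff (f j)) j _ x).trans ?_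
    refine (hb j _ (f j) (x j) ((norm_le_pi_norm x j).trans (hR x hx))).trans ?_
    rw [sum_apply]
    refine Finset.single_le_sum (f := fun i => s j i (f j)) (fun i _ => apply_nonneg _ _)
      (Finset.mem_range.2 (Nat.lt_succ_of_le ?_))
    exact (Multiset.count_le_card _ _).trans p.2.le

/-- The natural map from the algebraic tensor product to `C^∞(ℝᴺ)`, as a linear map. -/
def naturalLinear (hX : ∀ j, (X j).EmbedsSmooth) :
    (ProjTensor fun j => (X j).Elem) →ₗ[ℂ] SmoothFun N :=
  (PiTensorProduct.lift (prodFun hX) : (⨂[ℂ] j, (X j).Elem) →ₗ[ℂ] SmoothFun N)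

theorem naturalLinear_tprod (hX : ∀ j, (X j).EmbedsSmooth) (f : ∀ j, (X j).Elem) :
    naturalLinear hX (ProjTensor.tprod _ f) = prodFun hX f :=
  PiTensorProduct.lift.tprod f

/-- The natural map from the algebraic tensor product to `C^∞(ℝᴺ)`. -/
def naturalPre (hX : ∀ j, (X j).EmbedsSmooth) :
    (ProjTensor fun j => (X j).Elem) →L[ℂ] SmoothFun N where
  toLinearMap := naturalLinear hX
  cont := by
    refine (smoothFun_withSeminorms N).continuous_of_continuous_comp (naturalLinear hX) fun q => ?_
    obtain ⟨C, s, hs, hb⟩ := smoothSeminorm_prodFun_le hX q.1 q.2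
    refine continuous_of_tprod_bound ((smoothFamily N q).comp (naturalLinear hX))
      (C := C) hs fun x => ?_
    rw [Seminorm.comp_apply, naturalLinear_tprod]
    exact hb x

theorem naturalPre_tprod (hX : ∀ j, (X j).EmbedsSmooth) (f : ∀ j, (X j).Elem) :
    naturalPre hX (ProjTensor.tprod _ f) = prodFun hX f :=
  naturalLinear_tprod hX f

/-- The embedding of the algebraic tensor product into its completion. -/
def toCompl {ι : Type} (E : ι → Type) [∀ i, AddCommGroup (E i)] [∀ i, Module ℂ (E i)]
    [∀ i, TopologicalSpace (E i)] : ProjTensor E →L[ℂ] ComplTensor E where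
  toFun v := v
  map_add' := UniformSpace.Completion.coe_add
  map_smul' := UniformSpace.Completion.coe_smul
  cont := UniformSpace.Completion.continuous_coe _

/-- The natural map from the completed projective tensor product to `C^∞(ℝᴺ)`. -/
def natural (hX : ∀ j, (X j).EmbedsSmooth) :
    (ComplTensor fun j => (X j).Elem) →L[ℂ] SmoothFun N :=
  (naturalPre hX).extend (toCompl fun j => (X j).Elem)

theorem natural_coe (hX : ∀ j, (X j).EmbedsSmooth) (v : ProjTensor fun j => (X j).Elem) :
    natural hX (v : ComplTensor fun j => (X j).Elem) = naturalPre hX v :=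
  (naturalPre hX).extend_eq (e := toCompl fun j => (X j).Elem)
    UniformSpace.Completion.denseRange_coe (UniformSpace.Completion.isUniformInducing_coe _) v

theorem natural_elemTensor (hX : ∀ j, (X j).EmbedsSmooth) (f : ∀ j, (X j).Elem) :
    natural hX (elemTensor f) = prodFun hX f := by
  rw [elemTensor, natural_coe, naturalPre_tprod]

/-- Continuous linear maps on the completed projective tensor product are determined by their
values on elementary tensors. -/
theorem complTensor_hom_ext {ι : Type} {E : ι → Type} [∀ i, AddCommGroup (E i)]
    [∀ i, Module ℂ (E i)] [∀ i, TopologicalSpace (E i)] {G : Type*} [AddCommGroup G] [Module ℂ G]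
    [TopologicalSpace G] [T2Space G] {S T : ComplTensor E →ₗ[ℂ] G} (hS : Continuous S)
    (hT : Continuous T) (h : ∀ x, S (elemTensor x) = T (elemTensor x)) : S = T := by
  refine LinearMap.ext fun z => ?_
  refine UniformSpace.Completion.induction_on z (isClosed_eq hS hT) fun v => ?_
  induction v using ProjTensor.induction with
  | smul_tprod c x =>
    rw [UniformSpace.Completion.coe_smul, map_smul, map_smul]
    exact congrArg _ (h x)
  | add v w hv hw => rw [UniformSpace.Completion.coe_add, map_add, map_add, hv, hw]

end Natural

/-! ### Maps that are limits of finite rank maps with integral functionals -/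

section Expansion

variable {N : ℕ}

theorem hasCompactSupport_prod {G : Fin N → ℝ → ℂ} (hG : ∀ j, HasCompactSupport (G j)) :
    HasCompactSupport fun y : Fin N → ℝ => ∏ j, G j (y j) := by
  refine HasCompactSupport.intro (isCompact_univ_pi fun j => hG j) fun y hy => ?_
  obtain ⟨j, hj⟩ : ∃ j, y j ∉ tsupport (G j) := by simpa using hy
  exact Finset.prod_eq_zero (Finset.mem_univ j) (image_eq_zero_of_notMem_tsupport hj)

theorem continuous_scale (φ : SmoothFun N) (t : Fin N → ℝ) :
    Continuous fun y : Fin N → ℝ => φ fun j => t j * y j :=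
  φ.contDiff.continuous.comp (continuous_pi fun j => continuous_const.mul (continuous_apply j))

theorem integrable_scale_mul (φ : SmoothFun N) (t : Fin N → ℝ) {H : (Fin N → ℝ) → ℂ}
    (hH : Continuous H) (hc : HasCompactSupport H) :
    Integrable fun y : Fin N → ℝ => φ (fun j => t j * y j) * H y :=
  ((continuous_scale φ t).mul hH).integrable_of_hasCompactSupport hc.mul_left

/-- The functional `φ ↦ ∫ φ(t y) H(y) dy` for a continuous function `H` of compact support. -/
def integralFunctional (t : Fin N → ℝ) {H : (Fin N → ℝ) → ℂ} (hH : Continuous H)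
    (hc : HasCompactSupport H) : SmoothFun N →ₗ[ℂ] ℂ where
  toFun φ := ∫ y, φ (fun j => t j * y j) * H y
  map_add' φ ψ := by
    rw [← integral_add (integrable_scale_mul φ t hH hc) (integrable_scale_mul ψ t hH hc)]
    exact integral_congr_ae (Eventually.of_forall fun y => add_mul _ _ _)
  map_smul' c φ := by
    rw [RingHom.id_apply, smul_eq_mul, ← integral_const_mul]
    exact integral_congr_ae (Eventually.of_forall fun y => mul_assoc _ _ _)

theorem continuous_integralFunctional (t : Fin N → ℝ) {H : (Fin N → ℝ) → ℂ} (hH : Continuous H)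
    (hc : HasCompactSupport H) : Continuous (integralFunctional t hH hc) := by
  let K : TopologicalSpace.Compacts (Fin N → ℝ) := ⟨(fun y j => t j * y j) '' tsupport H,
    hc.isCompact.image (continuous_pi fun j => continuous_const.mul (continuous_apply j))⟩
  have hb : ∀ φ, ‖integralFunctional t hH hc φ‖ ≤ (∫ y, ‖H y‖) * smoothSeminorm N K 0 φ := by
    intro φ
    rw [← integral_mul_const]
    refine norm_integral_le_of_norm_le
      ((hH.integrable_of_hasCompactSupport hc).norm.mul_const _) (Eventually.of_forall fun y => ?_)
    rw [norm_mul, mul_comm]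
    by_cases hy : y ∈ tsupport H
    · exact mul_le_mul_of_nonneg_left (norm_le_smoothSeminorm K φ ⟨y, hy, rfl⟩) (norm_nonneg _)
    · simp [image_eq_zero_of_notMem_tsupport hy]
  refine continuous_of_continuousAt_zero (integralFunctional t hH hc).toAddMonoidHom ?_
  have h0 : Tendsto (fun φ => (∫ y, ‖H y‖) * smoothSeminorm N K 0 φ) (𝓝 0) (𝓝 0) := by
    have := ((smoothSeminorm_continuous K 0).tendsto 0).const_mul (∫ y, ‖H y‖)
    simpa using this
  have := squeeze_zero_norm hb h0
  simpa [ContinuousAt] using this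

variable {X Y : Fin N → FunctionSpace}

/-- The functionals of the form `f ↦ ∫ f(t y) G(y) dy` with `G` continuous of compact support. -/
def IsIntegralFunctional {X : FunctionSpace} (c : X.Elem →L[ℂ] ℂ) : Prop :=
  ∃ (t : ℝ) (G : ℝ → ℂ), Continuous G ∧ HasCompactSupport G ∧ ∀ f : X.Elem, c f = ∫ y, f (t * y) * G y

/-- The map `A` is the sum of a series of maps of rank one with integral functionals, in such a
way that the partial sums are equicontinuous. -/
def HasExpansion {X Y : FunctionSpace} (A : X.Elem →L[ℂ] Y.Elem) : Prop :=
  ∃ (c : ℤ → X.Elem →L[ℂ] ℂ) (e : ℤ → Y.Elem), (∀ a, IsIntegralFunctional (c a)) ∧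
    (∀ j, ∃ s : Seminorm ℂ X.Elem, Continuous s ∧
      ∀ (S : Finset ℤ) f, Y.family j (∑ a ∈ S, c a f • e a) ≤ s f) ∧
    ∀ f, Tendsto (fun S : Finset ℤ => ∑ a ∈ S, c a f • e a) atTop (𝓝 (A f))

/-- The map `A` is the limit of an equicontinuous sequence of maps with an expansion. -/
def HasApproximation {X Y : FunctionSpace} (A : X.Elem →L[ℂ] Y.Elem) : Prop :=
  ∃ C : ℕ → X.Elem →L[ℂ] Y.Elem, (∀ r, HasExpansion (C r)) ∧
    (∀ j, ∃ s : Seminorm ℂ X.Elem, Continuous s ∧ ∀ r f, Y.family j (C r f) ≤ s f) ∧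
    ∀ f, Tendsto (fun r => C r f) atTop (𝓝 (A f))

/-- A tensor product of finite rank maps with integral functionals kills the kernel of the natural
map. -/
theorem completion_map_finiteRank_eq_zero (hX : ∀ j, (X j).EmbedsSmooth)
    (c : ∀ j, ℤ → (X j).Elem →L[ℂ] ℂ) (e : ∀ j, ℤ → (Y j).Elem)
    (hc : ∀ j a, IsIntegralFunctional (c j a)) (S : Finset ℤ)
    (u : ComplTensor fun j => (X j).Elem) (hu : natural hX u = 0) :
    (ProjTensor.map fun j => ∑ a ∈ S, (c j a).smulRight (e j a)).completion u = 0 := by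
  classical
  choose t G hG hGc hcG using hc
  let Λ : (Fin N → ℤ) → SmoothFun N →ₗ[ℂ] ℂ := fun κ =>
    integralFunctional (fun j => t j (κ j)) (H := fun y => ∏ j, G j (κ j) (y j))
      (continuous_finsetProd _ fun j _ => (hG j (κ j)).comp (continuous_apply j))
      (hasCompactSupport_prod fun j => hGc j (κ j))
  have hΛ : ∀ κ, Continuous (Λ κ) := fun κ => continuous_integralFunctional _ _ _
  -- Fubini's theorem for a product function against a product kernel.
  have hΛp : ∀ κ f, Λ κ (prodFun hX f) = ∏ j, c j (κ j) (f j) := by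
    intro κ f
    simp only [hcG]
    rw [← integral_fintype_prod_volume_eq_prod]
    refine integral_congr_ae (Eventually.of_forall fun y => ?_)
    simp only [prodFun_apply, Finset.prod_mul_distrib]
  -- This is the factorization through the natural map. Both sides are continuous, so elementary
  -- tensors suffice, where it is the multilinear expansion of a product of sums.
  have key : (ProjTensor.map fun j => ∑ a ∈ S, (c j a).smulRight (e j a)).completion.toLinearMap =
      ∑ κ ∈ Fintype.piFinset fun _ => S, (Λ κ ∘ₗ (natural hX).toLinearMap).smulRight
        (elemTensor fun j => e j (κ j)) := by
    refine complTensor_hom_ext (ContinuousLinearMap.continuous _) ?_ fun x => ?_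
    · simp only [LinearMap.coe_sum]
      have : Continuous fun z => ∑ κ ∈ Fintype.piFinset fun _ : Fin N => S,
          Λ κ (natural hX z) • elemTensor fun j => e j (κ j) :=
        continuous_finsetSum _ fun κ _ => by
          simp only [elemTensor, ← UniformSpace.Completion.coe_smul]
          have hc : Continuous fun z => Λ κ (natural hX z) := (hΛ κ).comp (natural hX).continuous
          have hcs : Continuous fun z => Λ κ (natural hX z) •
              (ProjTensor.tprod (fun j => (Y j).Elem) fun j => e j (κ j)) := by fun_prop
          exact (UniformSpace.Completion.continuous_coe _).comp hcs
      convert this using 1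
      ext z
      simp
    · rw [LinearMap.sum_apply]
      simp only [LinearMap.smulRight_apply, LinearMap.comp_apply, ContinuousLinearMap.coe_coe,
        natural_elemTensor, hΛp]
      rw [elemTensor, ContinuousLinearMap.completion_apply_coe]
      have h2 : (ProjTensor.map fun j => ∑ a ∈ S, (c j a).smulRight (e j a))
          (ProjTensor.tprod _ x) = ProjTensor.tprod _ fun j => ∑ a ∈ S, c j a (x j) • e j a := by
        refine (ProjTensor.mapLinear_tprod _ x).trans ?_
        congr 1
        ext j : 1
        simp
      rw [h2, MultilinearMap.map_sum_finset]
      simp only [MultilinearMap.map_smul_univ, elemTensor]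
      exact (map_sum (toCompl fun j => (Y j).Elem) _ _).trans
        (Finset.sum_congr rfl fun κ _ => UniformSpace.Completion.coe_smul _ _)
  have h := LinearMap.congr_fun key u
  rw [LinearMap.sum_apply] at h
  refine h.trans (Finset.sum_eq_zero fun κ _ => ?_)
  simp [hu]

variable [NeZero N]

theorem completion_map_eq_zero_of_hasExpansion (hX : ∀ j, (X j).EmbedsSmooth)
    (A : ∀ j, (X j).Elem →L[ℂ] (Y j).Elem) (hA : ∀ j, HasExpansion (A j))
    (u : ComplTensor fun j => (X j).Elem) (hu : natural hX u = 0) :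
    (ProjTensor.map A).completion u = 0 := by
  choose c e hc hs hlim using hA
  have happ : ∀ (S : Finset ℤ) j f,
      (∑ a ∈ S, (c j a).smulRight (e j a) : (X j).Elem →L[ℂ] (Y j).Elem) f =
        ∑ a ∈ S, c j a f • e j a := fun S j f => by simp
  refine completion_map_eq_zero atTop (fun S j => ∑ a ∈ S, (c j a).smulRight (e j a)) A ?_ ?_ u
    fun S => completion_map_finiteRank_eq_zero hX c e hc S u hu
  · intro j i
    obtain ⟨s, hsc, hb⟩ := hs j i
    exact ⟨s, hsc, fun S f => by rw [happ]; exact hb S f⟩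
  · intro j f
    simpa only [happ] using hlim j f

/-- A tensor product of maps that have an approximation kills the kernel of the natural map. -/
theorem completion_map_eq_zero_of_hasApproximation (hX : ∀ j, (X j).EmbedsSmooth)
    (A : ∀ j, (X j).Elem →L[ℂ] (Y j).Elem) (hA : ∀ j, HasApproximation (A j))
    (u : ComplTensor fun j => (X j).Elem) (hu : natural hX u = 0) :
    (ProjTensor.map A).completion u = 0 := by
  choose C hC hs hlim using hA
  exact completion_map_eq_zero atTop (fun r j => C j r) A hs hlim u fun r =>
    completion_map_eq_zero_of_hasExpansion hX (fun j => C j r) (fun j => hC j r) u hu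

end Expansion

/-! ### Cutoff functions -/

theorem norm_iteratedDeriv_mul_le {f g : ℝ → ℂ} (hf : ContDiff ℝ ∞ f) (hg : ContDiff ℝ ∞ g)
    (n : ℕ) (x : ℝ) :
    ‖iteratedDeriv n (fun y => f y * g y) x‖ ≤ ∑ i ∈ Finset.range (n + 1),
      (n.choose i : ℝ) * ‖iteratedDeriv i f x‖ * ‖iteratedDeriv (n - i) g x‖ := by
  simpa only [norm_iteratedFDeriv_eq_norm_iteratedDeriv] using
    norm_iteratedFDeriv_mul_le hf hg x (n := n) (by exact_mod_cast le_top)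

theorem iteratedDeriv_scale {f : ℝ → ℂ} (hf : ContDiff ℝ ∞ f) (a : ℝ) (n : ℕ) (x : ℝ) :
    iteratedDeriv n (fun y => f (a * y)) x = a ^ n • iteratedDeriv n f (a * x) :=
  congrFun (iteratedDeriv_comp_const_smul (hf.of_le (by exact_mod_cast le_top)) a) x

theorem iteratedDeriv_eq_zero_of_lt {f : ℝ → ℂ} {r : ℝ} (hf : ∀ x, r ≤ |x| → f x = 0) (n : ℕ) {x : ℝ}
    (hx : r < |x|) : iteratedDeriv n f x = 0 := by
  have h : f =ᶠ[𝓝 x] fun _ => 0 :=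
    (continuous_abs.continuousAt.eventually_const_lt hx).mono fun y hy => hf y hy.le
  rw [h.iteratedDeriv_eq]
  simp

theorem hasCompactSupport_of_abs {f : ℝ → ℂ} {r : ℝ} (hf : ∀ x, r ≤ |x| → f x = 0) :
    HasCompactSupport f := by
  refine HasCompactSupport.intro (isCompact_Icc (a := -r) (b := r)) fun x hx => hf x ?_
  by_contra! h
  exact hx (abs_le.1 h.le)

/-- A smooth function that is one on `[-1, 1]` and zero outside `(-2, 2)`. -/
def cutoff (x : ℝ) : ℂ := ((⟨1, 2, one_pos, one_lt_two⟩ : ContDiffBump (0 : ℝ)) x : ℝ)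

theorem cutoff_contDiff : ContDiff ℝ ∞ cutoff :=
  Complex.ofRealCLM.contDiff.comp (ContDiffBump.contDiff _)

theorem cutoff_eq_one {x : ℝ} (hx : |x| ≤ 1) : cutoff x = 1 := by
  rw [cutoff, ContDiffBump.one_of_mem_closedBall, Complex.ofReal_one]
  simpa using hx

theorem cutoff_eq_zero {x : ℝ} (hx : 2 ≤ |x|) : cutoff x = 0 := by
  rw [cutoff, ContDiffBump.zero_of_le_dist, Complex.ofReal_zero]
  simpa using hx

theorem cutoff_scale_contDiff (a : ℝ) : ContDiff ℝ ∞ fun x => cutoff (a * x) :=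
  cutoff_contDiff.comp (contDiff_const.mul contDiff_id)

/-- The shift by 8 is chosen so that `8 / T * (1 + |x|) ≤ 8 + |8 / T * x|` for `T ≥ 1`, which later
gives bounds uniform in the scale. -/
theorem cutoff_bound (i k : ℕ) : ∃ M, 0 ≤ M ∧ ∀ y, (8 + |y|) ^ k * ‖iteratedDeriv i cutoff y‖ ≤ M := by
  have hc : Continuous fun y => ((8 + |y|) ^ k : ℝ) • iteratedDeriv i cutoff y := by
    have := cutoff_contDiff.continuous_iteratedDeriv i (by exact_mod_cast le_top)
    fun_prop
  have hs : HasCompactSupport fun y => ((8 + |y|) ^ k : ℝ) • iteratedDeriv i cutoff y := by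
    refine hasCompactSupport_of_abs (r := 3) fun x hx => ?_
    rw [iteratedDeriv_eq_zero_of_lt (fun _ => cutoff_eq_zero) i (by linarith), smul_zero]
  obtain ⟨M, hM⟩ := hs.exists_bound_of_continuous hc
  have h : ∀ y, (8 + |y|) ^ k * ‖iteratedDeriv i cutoff y‖ ≤ M := fun y => by
    have := hM y
    rwa [norm_smul, Real.norm_of_nonneg (by positivity)] at this
  exact ⟨M, (by positivity : (0 : ℝ) ≤ _).trans (h 0), h⟩

/-- The function no longer has compact support, but at order zero only boundedness is asked, and the
higher derivatives are those of `cutoff`. -/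
theorem cutoff_sub_one_bound (i : ℕ) :
    ∃ M, 0 ≤ M ∧ ∀ y, (8 + |y|) ^ i * ‖iteratedDeriv i (fun x => cutoff x - 1) y‖ ≤ M := by
  obtain ⟨M, hM0, hM⟩ := cutoff_bound i i
  rcases i with _ | i
  · refine ⟨M + 1, by linarith, fun y => ?_⟩
    have h1 := hM y
    simp only [pow_zero, one_mul, iteratedDeriv_zero] at h1 ⊢
    refine (norm_sub_le _ _).trans ?_
    simpa using h1
  · refine ⟨M, hM0, fun y => ?_⟩
    have h2 : iteratedDeriv (i + 1) (fun x => cutoff x - 1) = iteratedDeriv (i + 1) cutoff := by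
      rw [iteratedDeriv_succ', iteratedDeriv_succ']
      congr 1
      ext x
      exact deriv_sub_const _
    rw [h2]
    exact hM y

/-! ### Fourier expansion -/

/-- The character `y ↦ exp(2 π i a y)`. -/
def character (a y : ℝ) : ℂ := Complex.exp (2 * Real.pi * a * Complex.I * y)

theorem character_contDiff (a : ℝ) : ContDiff ℝ ∞ (character a) :=
  (contDiff_const.mul Complex.ofRealCLM.contDiff).cexp

theorem norm_character (a y : ℝ) : ‖character a y‖ = 1 := by
  have h : (2 * Real.pi * a * Complex.I * y : ℂ) = ((2 * Real.pi * a * y : ℝ) : ℂ) * Complex.I := by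
    push_cast
    ring
  rw [character, h, Complex.norm_exp_ofReal_mul_I]

theorem norm_iteratedDeriv_character (a : ℝ) (n : ℕ) (y : ℝ) :
    ‖iteratedDeriv n (character a) y‖ = (2 * Real.pi * |a|) ^ n := by
  have h : iteratedDeriv n (character a) =
      fun y => (2 * Real.pi * a * Complex.I) ^ n * character a y := by
    induction n with
    | zero => simp
    | succ n ih =>
      rw [iteratedDeriv_succ, ih]
      ext y
      have h1 : HasDerivAt (fun y : ℝ => (2 * Real.pi * a * Complex.I * y : ℂ))
          (2 * Real.pi * a * Complex.I * 1) y := (Complex.ofRealCLM.hasDerivAt).const_mul _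
      have h2 := (h1.cexp.const_mul ((2 * Real.pi * a * Complex.I) ^ n)).deriv
      refine h2.trans ?_
      rw [character]
      ring
  rw [h, norm_mul, norm_character, mul_one, norm_pow]
  simp [abs_of_pos Real.pi_pos]

open scoped FourierTransform in
theorem fourier_eq_integral_character (g : ℝ → ℂ) (a : ℝ) :
    𝓕 g a = ∫ y, g y * character (-a) y := by
  rw [Real.fourier_real_eq_integral_exp_smul]
  refine integral_congr_ae (Eventually.of_forall fun y => ?_)
  simp only [smul_eq_mul, character]
  rw [mul_comm]
  congr 2
  push_cast
  ring

theorem norm_integral_character_le {g : ℝ → ℂ} (h0 : ∀ y, 1 / 4 < |y| → g y = 0) {B : ℝ}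
    (hB : ∀ y, ‖g y‖ ≤ B) (a : ℝ) : ‖∫ y, g y * character a y‖ ≤ B := by
  have hB0 : 0 ≤ B := (norm_nonneg _).trans (hB 0)
  rw [← setIntegral_eq_integral_of_forall_compl_eq_zero (s := Set.Icc (-(1 / 4) : ℝ) (1 / 4))]
  · refine (norm_setIntegral_le_of_norm_le_const (C := B) (by simp) fun y _ => ?_).trans ?_
    · rw [norm_mul, norm_character, mul_one]
      exact hB y
    · rw [Real.volume_real_Icc_of_le (by norm_num)]
      linarith
  · intro y hy
    rw [h0 y, zero_mul]
    by_contra! h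
    exact hy (abs_le.1 h)

/-- The Fourier coefficients of a smooth function supported in `[-1/4, 1/4]` decay rapidly. -/
theorem norm_integral_character_mul_le {g : ℝ → ℂ} (hg : ContDiff ℝ ∞ g)
    (h0 : ∀ y, 1 / 4 ≤ |y| → g y = 0) (r : ℕ) {B : ℝ}
    (hB0 : ∀ y, ‖g y‖ ≤ B) (hB : ∀ y, ‖iteratedDeriv r g y‖ ≤ B) (a : ℝ) :
    ‖∫ y, g y * character (-a) y‖ * (1 + |a|) ^ r ≤ 2 ^ r * B := by
  set c := ∫ y, g y * character (-a) y with hc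
  have h1 : ‖c‖ ≤ B := norm_integral_character_le (fun y hy => h0 y hy.le) hB0 _
  have h2 : (2 * Real.pi * |a|) ^ r * ‖c‖ ≤ B := by
    have h3 := norm_integral_character_le
      (fun y hy => iteratedDeriv_eq_zero_of_lt h0 r hy) hB (-a)
    rw [← fourier_eq_integral_character, Real.fourier_iteratedDeriv (N := ⊤) hg
      (fun n _ => (hg.continuous_iteratedDeriv n (by exact_mod_cast le_top)).integrable_of_hasCompactSupport
        (hasCompactSupport_of_abs (r := 1 / 2) fun x hx =>
          iteratedDeriv_eq_zero_of_lt h0 n (by linarith))) le_top] at h3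
    beta_reduce at h3
    rw [fourier_eq_integral_character, norm_smul, norm_pow] at h3
    simpa [abs_of_pos Real.pi_pos] using h3
  have ha := abs_nonneg a
  have hpi := Real.pi_gt_three
  -- For small `|a|` the bound on `g` suffices, as `1 + |a| ≤ 2`. For large `|a|` one has `1 + |a| ≤
  -- 2 * |a|`, and the bound on the `r`-th derivative applies.
  rcases le_total |a| 1 with h | h
  · have h4 : (1 + |a|) ^ r ≤ 2 ^ r := pow_le_pow_left₀ (by positivity) (by linarith) r
    calc ‖c‖ * (1 + |a|) ^ r ≤ B * 2 ^ r :=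
          mul_le_mul h1 h4 (by positivity) ((norm_nonneg _).trans h1)
      _ = 2 ^ r * B := mul_comm _ _
  · have h4 : (1 + |a|) ^ r ≤ (2 * |a|) ^ r := pow_le_pow_left₀ (by positivity) (by linarith) r
    have h5 : |a| ^ r ≤ (2 * Real.pi * |a|) ^ r :=
      pow_le_pow_left₀ ha (by nlinarith) r
    calc ‖c‖ * (1 + |a|) ^ r ≤ ‖c‖ * (2 * |a|) ^ r := by gcongr
      _ = 2 ^ r * (|a| ^ r * ‖c‖) := by rw [mul_pow]; ring
      _ ≤ 2 ^ r * ((2 * Real.pi * |a|) ^ r * ‖c‖) := by gcongr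
      _ ≤ 2 ^ r * B := by gcongr

/-- Poisson summation equates the Fourier series with the sum of the integer translates of `g`. For
`|y| ≤ 1/2` the other translates vanish, since `|y + a| ≥ 1/2` for `a ≠ 0`. -/
theorem tsum_character {g : ℝ → ℂ} (hg : ContDiff ℝ ∞ g)
    (h0 : ∀ y, 1 / 4 ≤ |y| → g y = 0) {y : ℝ} (hy : |y| ≤ 1 / 2) :
    ∑' a : ℤ, (∫ y, g y * character (-a) y) * character a y = g y := by
  have h := ((hasCompactSupport_of_abs h0).toSchwartzMap hg).tsum_eq_tsum_fourier y
  rw [tsum_eq_single 0] at h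
  · simp only [HasCompactSupport.toSchwartzMap_toFun, Int.cast_zero, add_zero] at h
    rw [h]
    refine tsum_congr fun a => ?_
    congr 1
    · rw [← fourier_eq_integral_character]
      rfl
    · rw [fourier_coe_apply, character]
      congr 1
      push_cast
      ring
  · intro a ha
    refine h0 _ ?_
    have h1 : (1 : ℝ) ≤ |(a : ℝ)| := by exact_mod_cast Int.one_le_abs ha
    have h2 : |(a : ℝ)| ≤ |y + a| + |y| := by
      have := abs_sub (y + a) y
      simpa using this
    linarith

/-! ### Approximation of inclusions of weighted spaces -/

/-- The seminorms of `X` control `sup w_j |f⁽ʲ⁾|`, those of `Y` are controlled by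
`sup w'_j |f⁽ʲ⁾|`, and the weights `w'` are smaller than the weights `w`. -/
structure WeightedPair (X Y : FunctionSpace) (w w' : ℕ → ℝ → ℝ) : Prop where
  le : X.Le Y
  contDiff : ∀ f : X.Elem, ContDiff ℝ ∞ (f : ℝ → ℂ)
  continuous_left : ∀ j, Continuous (w j)
  pos_left : ∀ j x, 0 < w j x
  continuous_right : ∀ j, Continuous (w' j)
  nonneg_right : ∀ j x, 0 ≤ w' j x
  lower : ∀ j, ∃ s : Seminorm ℂ X.Elem, Continuous s ∧
    ∀ (f : X.Elem) x, w j x * ‖iteratedDeriv j (f : ℝ → ℂ) x‖ ≤ s f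
  mem : ∀ g : ℝ → ℂ, ContDiff ℝ ∞ g → HasCompactSupport g → g ∈ Y.carrier
  upper : ∀ j (g : Y.Elem) B, 0 ≤ B → (∀ x, w' j x * ‖iteratedDeriv j (g : ℝ → ℂ) x‖ ≤ B) →
    Y.family j g ≤ B
  ratio : ∀ i j, i ≤ j → ∃ C, 0 ≤ C ∧
    ∀ x, w' j x * (1 + |x|) ≤ C * (w i x * (1 + |x|) ^ (j - i))

theorem FunctionSpace.exists_sum_le {X : FunctionSpace} {κ : Type*} (t : Finset κ) (a : κ → ℝ)
    (s : κ → Seminorm ℂ X.Elem) (hs : ∀ i, Continuous (s i)) :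
    ∃ p : Seminorm ℂ X.Elem, Continuous p ∧ ∀ f, ∑ i ∈ t, a i * s i f ≤ p f := by
  have h1 : ∀ f, (∑ i ∈ t, ‖a i‖₊ • s i) f = ∑ i ∈ t, |a i| * s i f := by
    intro f
    rw [sum_apply]
    rfl
  refine ⟨∑ i ∈ t, ‖a i‖₊ • s i, ?_, fun f => ?_⟩
  · have h2 : ⇑(∑ i ∈ t, ‖a i‖₊ • s i) = fun f => ∑ i ∈ t, |a i| * s i f := funext h1
    rw [h2]
    exact continuous_finsetSum _ fun i _ => continuous_const.mul (hs i)
  · rw [h1]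
    exact Finset.sum_le_sum fun i _ =>
      mul_le_mul_of_nonneg_right (le_abs_self _) (apply_nonneg _ _)

namespace WeightedPair

variable {X Y : FunctionSpace} {w w' : ℕ → ℝ → ℝ}

theorem embedsSmooth (h : WeightedPair X Y w w') : X.EmbedsSmooth := by
  refine ⟨h.contDiff, fun R i => ?_⟩
  obtain ⟨s, hs, hb⟩ := h.lower i
  obtain ⟨C, hC⟩ := (isCompact_Icc (a := -R) (b := R)).bddAbove_image
    ((h.continuous_left i).inv₀ fun x => (h.pos_left i x).ne').continuousOn
  obtain ⟨p, hp, hbp⟩ := FunctionSpace.exists_sum_le {()} (fun _ => C) (fun _ => s) fun _ => hs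
  refine ⟨p, hp, fun f x hx => ?_⟩
  have h1 := hbp f
  rw [Finset.sum_singleton] at h1
  refine le_trans ?_ h1
  have h2 : (w i x)⁻¹ ≤ C := hC ⟨x, abs_le.1 hx, rfl⟩
  have h3 : ‖iteratedDeriv i (f : ℝ → ℂ) x‖ ≤ (w i x)⁻¹ * s f := by
    rw [← div_eq_inv_mul, le_div_iff₀ (h.pos_left i x), mul_comm]
    exact hb f x
  exact h3.trans (mul_le_mul_of_nonneg_right h2 (apply_nonneg _ _))

/-- Multiplication by a slowly varying function is bounded, uniformly in the scale. -/
theorem exists_scale_bound (h : WeightedPair X Y w w') {θ : ℝ → ℂ} (hθ : ContDiff ℝ ∞ θ)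
    (hb : ∀ i, ∃ M, 0 ≤ M ∧ ∀ y, (8 + |y|) ^ i * ‖iteratedDeriv i θ y‖ ≤ M) (j : ℕ) :
    ∃ s : Seminorm ℂ X.Elem, Continuous s ∧ ∀ T : ℝ, 1 ≤ T → ∀ (f : X.Elem) x,
      w' j x * (1 + |x|) * ‖iteratedDeriv j (fun y => θ (8 / T * y) * f y) x‖ ≤ s f := by
  choose M hM0 hM using hb
  choose s hs hsb using h.lower
  choose! C hC0 hC using h.ratio
  obtain ⟨p, hp, hpb⟩ := FunctionSpace.exists_sum_le (Finset.range (j + 1))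
    (fun i => j.choose i * M i * C (j - i) j) (fun i => s (j - i)) fun i => hs _
  refine ⟨p, hp, fun T hT f x => le_trans ?_ (hpb f)⟩
  have hT0 : 0 < T := by linarith
  have hθT : ContDiff ℝ ∞ fun y => θ (8 / T * y) := hθ.comp (contDiff_const.mul contDiff_id)
  refine (mul_le_mul_of_nonneg_left (norm_iteratedDeriv_mul_le hθT (h.contDiff f) j x)
    (mul_nonneg (h.nonneg_right j x) (by positivity))).trans ?_
  rw [Finset.mul_sum]
  refine Finset.sum_le_sum fun i hi => ?_
  have hij : i ≤ j := Nat.lt_succ_iff.1 (Finset.mem_range.1 hi)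
  -- An `i`-th derivative of the rescaled multiplier gains `(1 + |x|) ^ (-i)` uniformly in `T`. This
  -- pays for the power `(1 + |x|) ^ i` that `ratio` costs when only `j - i` derivatives fall on
  -- `f`.
  have h1 : (1 + |x|) ^ i * ‖iteratedDeriv i (fun y => θ (8 / T * y)) x‖ ≤ M i := by
    refine le_trans ?_ (hM i (8 / T * x))
    rw [iteratedDeriv_scale hθ, norm_smul, norm_pow, ← mul_assoc, ← mul_pow]
    refine mul_le_mul_of_nonneg_right (pow_le_pow_left₀ (by positivity) ?_ i) (norm_nonneg _)
    have h8 : 8 / T ≤ 8 := div_le_self (by norm_num) hT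
    rw [Real.norm_of_nonneg (by positivity), abs_mul, abs_of_nonneg (by positivity : 0 ≤ 8 / T)]
    nlinarith
  have h2 := hC (j - i) j (Nat.sub_le _ _) x
  rw [Nat.sub_sub_self hij] at h2
  have h3 := hsb (j - i) f x
  set a := ‖iteratedDeriv i (fun y => θ (8 / T * y)) x‖
  set b := ‖iteratedDeriv (j - i) (f : ℝ → ℂ) x‖
  have hC0' := hC0 (j - i) j (Nat.sub_le _ _)
  calc w' j x * (1 + |x|) * (j.choose i * a * b)
      ≤ C (j - i) j * (w (j - i) x * (1 + |x|) ^ i) * (j.choose i * a * b) := by gcongr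
    _ = j.choose i * ((1 + |x|) ^ i * a) * C (j - i) j * (w (j - i) x * b) := by ring
    _ ≤ j.choose i * M i * C (j - i) j * s (j - i) f := by
        have := h.pos_left (j - i) x
        have := hM0 i
        gcongr

/-- Multiplication by the cutoff function of scale `T`, as a linear map. -/
def cutoffLinear (h : WeightedPair X Y w w') (T : ℝ) (hT : 1 ≤ T) : X.Elem →ₗ[ℂ] Y.Elem where
  toFun f := ⟨fun x => cutoff (8 / T * x) * f x, h.mem _
    ((cutoff_scale_contDiff _).mul (h.contDiff f)) (HasCompactSupport.mul_right
      -- The multiplier is one up to `|x| = T / 8` and vanishes from `T / 4` on.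
      (hasCompactSupport_of_abs (r := T / 4) fun x hx => cutoff_eq_zero (by
        have : 0 < T := by linarith
        rw [abs_mul, abs_of_nonneg (by positivity)]
        calc (2 : ℝ) = 8 / T * (T / 4) := by field_simp; norm_num
          _ ≤ 8 / T * |x| := by gcongr)))⟩
  map_add' f g := Subtype.ext (funext fun x => mul_add _ _ _)
  map_smul' c f := Subtype.ext (funext fun x => mul_left_comm _ _ _)

theorem exists_cutoffLinear_bound (h : WeightedPair X Y w w') (j : ℕ) :
    ∃ s : Seminorm ℂ X.Elem, Continuous s ∧ ∀ T (hT : 1 ≤ T) f,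
      Y.family j (h.cutoffLinear T hT f) ≤ s f := by
  obtain ⟨s, hs, hb⟩ := h.exists_scale_bound cutoff_contDiff (fun i => cutoff_bound i i) j
  refine ⟨s, hs, fun T hT f => h.upper j _ _ (apply_nonneg _ _) fun x => ?_⟩
  refine le_trans ?_ (hb T hT f x)
  exact mul_le_mul_of_nonneg_right
    (le_mul_of_one_le_right (h.nonneg_right j x) (by linarith [abs_nonneg x])) (norm_nonneg _)

/-- Multiplication by the cutoff function of scale `T`. -/
def cutoffMul (h : WeightedPair X Y w w') (T : ℝ) (hT : 1 ≤ T) : X.Elem →L[ℂ] Y.Elem where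
  toLinearMap := h.cutoffLinear T hT
  cont := FunctionSpace.continuous_of_bound _ fun j => by
    obtain ⟨s, hs, hb⟩ := h.exists_cutoffLinear_bound j
    exact ⟨s, hs, fun f => hb T hT f⟩

/-- The difference vanishes for `|x| < T / 8`. Elsewhere the spare factor `1 + |x|` in
`exists_scale_bound` is at least `1 + T / 8`, so each seminorm of the difference is at most `s f /
(1 + T / 8)`. -/
theorem tendsto_cutoffMul (h : WeightedPair X Y w w') (f : X.Elem) :
    Tendsto (fun r : ℕ => h.cutoffMul ((r : ℝ) + 1) (by linarith [r.cast_nonneg (α := ℝ)]) f) atTop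
      (𝓝 (FunctionSpace.incl h.le f)) := by
  refine (Y.withSeminorms.tendsto_nhds _ _).2 fun j ε hε => ?_
  obtain ⟨s, -, hb⟩ := h.exists_scale_bound (θ := fun x => cutoff x - 1)
    (cutoff_contDiff.sub contDiff_const) cutoff_sub_one_bound j
  have hlim : Tendsto (fun r : ℕ => s f / (1 + ((r : ℝ) + 1) / 8)) atTop (𝓝 0) := by
    refine Tendsto.div_atTop tendsto_const_nhds (tendsto_atTop_add_const_left _ _ ?_)
    exact (tendsto_atTop_add_const_right _ _ tendsto_natCast_atTop_atTop).atTop_div_const (by norm_num)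
  filter_upwards [hlim.eventually_lt_const hε] with r hr
  refine lt_of_le_of_lt ?_ hr
  have hT : (1 : ℝ) ≤ (r : ℝ) + 1 := by linarith [r.cast_nonneg (α := ℝ)]
  set T : ℝ := (r : ℝ) + 1
  have hT0 : 0 < T := by linarith
  refine h.upper j _ _ (div_nonneg (apply_nonneg _ _) (by positivity)) fun x => ?_
  have he : ((h.cutoffMul T hT f - FunctionSpace.incl h.le f : Y.Elem) : ℝ → ℂ) =
      fun x => (cutoff (8 / T * x) - 1) * f x := by
    ext x
    have : ((h.cutoffMul T hT f - FunctionSpace.incl h.le f : Y.Elem) : ℝ → ℂ) x =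
      cutoff (8 / T * x) * f x - f x := rfl
    rw [this]
    ring
  rw [he]
  rcases lt_or_ge |x| (T / 8) with hx | hx
  · have h0 : (fun x => (cutoff (8 / T * x) - 1) * f x) =ᶠ[𝓝 x] fun _ => (0 : ℂ) := by
      filter_upwards [continuous_abs.continuousAt.eventually_lt_const hx] with y hy
      rw [cutoff_eq_one, sub_self, zero_mul]
      rw [abs_mul, abs_of_nonneg (by positivity)]
      calc 8 / T * |y| ≤ 8 / T * (T / 8) := by gcongr
        _ = 1 := by field_simp
    rw [h0.iteratedDeriv_eq]
    simp only [iteratedDeriv_fun_const_zero, norm_zero, mul_zero]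
    exact div_nonneg (apply_nonneg _ _) (by positivity)
  · rw [le_div_iff₀ (by positivity)]
    refine le_trans ?_ (hb T hT f x)
    rw [mul_right_comm]
    have := h.nonneg_right j x
    gcongr

/-! ### The expansion of the cutoff operators -/

/-- The function `y ↦ cutoff(8 y) f(T y)`. -/
def localized (f : ℝ → ℂ) (T y : ℝ) : ℂ := cutoff (8 * y) * f (T * y)

theorem localized_contDiff (h : WeightedPair X Y w w') (f : X.Elem) (T : ℝ) :
    ContDiff ℝ ∞ (localized f T) :=
  (cutoff_scale_contDiff 8).mul ((h.contDiff f).comp (contDiff_const.mul contDiff_id))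

theorem localized_eq_zero (f : ℝ → ℂ) (T : ℝ) (y : ℝ) (hy : 1 / 4 ≤ |y|) : localized f T y = 0 := by
  rw [localized, cutoff_eq_zero, zero_mul]
  rw [abs_mul, abs_of_pos (by norm_num : (0 : ℝ) < 8)]
  linarith

/-- Only the values of `f` on `[-T, T]` enter, so no decay or growth condition on `f` is involved;
the price is that the seminorm depends on `T`. -/
theorem exists_localized_bound (h : WeightedPair X Y w w') {T : ℝ} (hT : 1 ≤ T) (r : ℕ) :
    ∃ s : Seminorm ℂ X.Elem, Continuous s ∧
      ∀ (f : X.Elem) y, ‖iteratedDeriv r (localized f T) y‖ ≤ s f := by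
  choose s hs hsb using h.embedsSmooth.bound T
  choose M hM0 hM using fun i => cutoff_bound i 0
  obtain ⟨p, hp, hpb⟩ := FunctionSpace.exists_sum_le (Finset.range (r + 1))
    (fun i => r.choose i * (8 ^ i * M i) * T ^ (r - i)) (fun i => s (r - i)) fun i => hs _
  refine ⟨p, hp, fun f y => ?_⟩
  rcases lt_or_ge (1 / 4) |y| with hy | hy
  · rw [iteratedDeriv_eq_zero_of_lt (localized_eq_zero f T) r hy, norm_zero]
    exact apply_nonneg _ _
  refine le_trans ?_ (hpb f)
  refine (norm_iteratedDeriv_mul_le (cutoff_scale_contDiff 8)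
    ((h.contDiff f).comp (contDiff_const.mul contDiff_id)) r y).trans ?_
  refine Finset.sum_le_sum fun i _ => ?_
  have h1 := hM i (8 * y)
  rw [pow_zero, one_mul] at h1
  have h2 := hsb (r - i) f (T * y) (by rw [abs_mul, abs_of_nonneg (by linarith)]; nlinarith)
  have h3 : ‖iteratedDeriv (r - i) (fun y => (f : ℝ → ℂ) (T * y)) y‖ ≤ T ^ (r - i) * s (r - i) f := by
    rw [iteratedDeriv_scale (h.contDiff f), norm_smul, norm_pow, Real.norm_of_nonneg (by linarith)]
    exact mul_le_mul_of_nonneg_left h2 (by positivity)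
  have h4 : ‖iteratedDeriv i (fun y => cutoff (8 * y)) y‖ ≤ 8 ^ i * M i := by
    rw [iteratedDeriv_scale cutoff_contDiff, norm_smul, norm_pow, Real.norm_of_nonneg (by norm_num)]
    gcongr
  have := hM0 i
  calc _ ≤ (r.choose i : ℝ) * (8 ^ i * M i) * (T ^ (r - i) * s (r - i) f) := by
        refine mul_le_mul (mul_le_mul_of_nonneg_left h4 (Nat.cast_nonneg _)) h3 (norm_nonneg _)
          (by positivity)
    _ = _ := by ring

/-- The Fourier coefficients of `y ↦ cutoff(8 y) f(T y)`, as a linear functional. -/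
def coeffLinear (h : WeightedPair X Y w w') (T : ℝ) (a : ℤ) : X.Elem →ₗ[ℂ] ℂ where
  toFun f := ∫ y, localized f T y * character (-a) y
  map_add' f g := by
    rw [← integral_add]
    · refine integral_congr_ae (Eventually.of_forall fun y => ?_)
      change cutoff (8 * y) * (f (T * y) + g (T * y)) * character (-a) y = _
      simp only [localized]
      ring
    all_goals
      exact ((localized_contDiff h _ T).continuous.mul
        (character_contDiff _).continuous).integrable_of_hasCompactSupport
          (hasCompactSupport_of_abs (localized_eq_zero _ T)).mul_right
  map_smul' c f := by
    rw [RingHom.id_apply, smul_eq_mul, ← integral_const_mul]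
    refine integral_congr_ae (Eventually.of_forall fun y => ?_)
    change cutoff (8 * y) * (c * f (T * y)) * character (-a) y = _
    simp only [localized]
    ring

theorem exists_coeffLinear_bound (h : WeightedPair X Y w w') {T : ℝ} (hT : 1 ≤ T) (r : ℕ) :
    ∃ s : Seminorm ℂ X.Elem, Continuous s ∧
      ∀ (a : ℤ) f, ‖h.coeffLinear T a f‖ * (1 + |(a : ℝ)|) ^ r ≤ s f := by
  obtain ⟨s₀, hs₀, hb₀⟩ := h.exists_localized_bound hT 0
  obtain ⟨s, hs, hb⟩ := h.exists_localized_bound hT r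
  obtain ⟨p, hp, hpb⟩ := FunctionSpace.exists_sum_le Finset.univ (fun _ => 2 ^ r)
    ![s₀, s] (by intro i; fin_cases i; exacts [hs₀, hs])
  refine ⟨p, hp, fun a f => ?_⟩
  have h1 := hpb f
  simp only [Fin.sum_univ_two, Matrix.cons_val_zero, Matrix.cons_val_one] at h1
  refine (norm_integral_character_mul_le (h.localized_contDiff f T) (localized_eq_zero f T) r
    -- The decay estimate needs one constant for the function and its `r`-th derivative; the sum
    -- dominates both.
    (B := s₀ f + s f) (fun y => ?_) (fun y => ?_) a).trans (by linarith)
  · have := hb₀ f y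
    rw [iteratedDeriv_zero] at this
    linarith [apply_nonneg s f]
  · linarith [hb f y, apply_nonneg s₀ f]

/-- The Fourier coefficients of `y ↦ cutoff(8 y) f(T y)`, as continuous functionals. -/
def coeff (h : WeightedPair X Y w w') {T : ℝ} (hT : 1 ≤ T) (a : ℤ) : X.Elem →L[ℂ] ℂ where
  toLinearMap := h.coeffLinear T a
  cont := by
    obtain ⟨s, hs, hb⟩ := h.exists_coeffLinear_bound hT 0
    refine continuous_of_continuousAt_zero (h.coeffLinear T a).toAddMonoidHom ?_
    have h0 : Tendsto (fun f => s f) (𝓝 0) (𝓝 0) := by simpa using hs.tendsto 0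
    have := squeeze_zero_norm (fun f => by simpa using hb a f) h0
    simpa [ContinuousAt] using this

theorem coeff_apply (h : WeightedPair X Y w w') {T : ℝ} (hT : 1 ≤ T) (a : ℤ) (f : X.Elem) :
    h.coeff hT a f = ∫ y, localized f T y * character (-a) y := rfl

theorem coeff_isIntegralFunctional (h : WeightedPair X Y w w') {T : ℝ} (hT : 1 ≤ T) (a : ℤ) :
    IsIntegralFunctional (h.coeff hT a) := by
  refine ⟨T, fun y => cutoff (8 * y) * character (-a) y,
    (cutoff_scale_contDiff 8).continuous.mul (character_contDiff _).continuous,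
    (hasCompactSupport_of_abs (r := 1 / 4) fun y hy => ?_).mul_right, fun f => ?_⟩
  · simpa [localized] using localized_eq_zero (fun _ => 1) 1 y hy
  · rw [coeff_apply]
    refine integral_congr_ae (Eventually.of_forall fun y => ?_)
    simp only [localized]
    ring

end WeightedPair

/-! ### Reconstruction of the cutoff operator from its Fourier coefficients -/

namespace WeightedPair

variable {X Y : FunctionSpace} {w w' : ℕ → ℝ → ℝ}

/-- The character of frequency `a / T`, cut off at `|x| = T / 2`. -/
def wave (T : ℝ) (a : ℤ) (x : ℝ) : ℂ := cutoff (4 / T * x) * character (a / T) x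

theorem wave_contDiff (T : ℝ) (a : ℤ) : ContDiff ℝ ∞ (wave T a) :=
  (cutoff_scale_contDiff _).mul (character_contDiff _)

theorem wave_eq_zero {T : ℝ} (hT : 1 ≤ T) (a : ℤ) (x : ℝ) (hx : T / 2 ≤ |x|) : wave T a x = 0 := by
  rw [wave, cutoff_eq_zero, zero_mul]
  rw [abs_mul, abs_of_nonneg (by positivity)]
  calc (2 : ℝ) = 4 / T * (T / 2) := by field_simp; norm_num
    _ ≤ 4 / T * |x| := by gcongr

theorem exists_wave_bound {T : ℝ} (hT : 1 ≤ T) (j : ℕ) : ∃ D, 0 ≤ D ∧ ∀ (a : ℤ) x,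
    ‖iteratedDeriv j (wave T a) x‖ ≤ D * (1 + |(a : ℝ)|) ^ j := by
  choose M hM0 hM using fun i => cutoff_bound i 0
  have hpi := Real.pi_pos
  refine ⟨∑ i ∈ Finset.range (j + 1), j.choose i * (4 ^ i * M i) * (2 * Real.pi) ^ (j - i),
    Finset.sum_nonneg fun i _ => by have := hM0 i; positivity, fun a x => ?_⟩
  refine (norm_iteratedDeriv_mul_le (cutoff_scale_contDiff _) (character_contDiff _) j x).trans ?_
  rw [Finset.sum_mul]
  refine Finset.sum_le_sum fun i _ => ?_
  have h1 := hM i (4 / T * x)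
  rw [pow_zero, one_mul] at h1
  have h4 : ‖iteratedDeriv i (fun y => cutoff (4 / T * y)) x‖ ≤ 4 ^ i * M i := by
    rw [iteratedDeriv_scale cutoff_contDiff, norm_smul, norm_pow, Real.norm_of_nonneg (by positivity)]
    have : 4 / T ≤ 4 := div_le_self (by norm_num) hT
    gcongr
  have h5 : ‖iteratedDeriv (j - i) (character (a / T)) x‖ ≤
      (2 * Real.pi) ^ (j - i) * (1 + |(a : ℝ)|) ^ j := by
    rw [norm_iteratedDeriv_character, mul_pow]
    have h6 : |(a : ℝ) / T| ≤ 1 + |(a : ℝ)| := by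
      rw [abs_div, abs_of_nonneg (by linarith : 0 ≤ T)]
      exact (div_le_self (abs_nonneg _) hT).trans (by linarith)
    have h7 : (1 + |(a : ℝ)|) ^ (j - i) ≤ (1 + |(a : ℝ)|) ^ j :=
      pow_le_pow_right₀ (by linarith [abs_nonneg (a : ℝ)]) (Nat.sub_le _ _)
    have h8 : |(a : ℝ) / T| ^ (j - i) ≤ (1 + |(a : ℝ)|) ^ (j - i) :=
      pow_le_pow_left₀ (abs_nonneg _) h6 _
    exact mul_le_mul_of_nonneg_left (h8.trans h7) (by positivity)
  have := hM0 i
  calc _ ≤ (j.choose i : ℝ) * (4 ^ i * M i) * ((2 * Real.pi) ^ (j - i) * (1 + |(a : ℝ)|) ^ j) := by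
        refine mul_le_mul (mul_le_mul_of_nonneg_left h4 (Nat.cast_nonneg _)) h5 (norm_nonneg _)
          (by positivity)
    _ = _ := by ring

/-- The waves vanish outside `[-T/2, T/2]`, where the continuous weight is bounded. -/
theorem exists_weighted_wave_bound (h : WeightedPair X Y w w') {T : ℝ} (hT : 1 ≤ T) (j : ℕ) :
    ∃ D, 0 ≤ D ∧ ∀ (a : ℤ) x,
      w' j x * ‖iteratedDeriv j (wave T a) x‖ ≤ D * (1 + |(a : ℝ)|) ^ j := by
  obtain ⟨D, hD0, hD⟩ := exists_wave_bound hT j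
  obtain ⟨W, hW⟩ := (isCompact_Icc (a := -(T / 2)) (b := T / 2)).bddAbove_image
    (h.continuous_right j).continuousOn
  have hWx : ∀ x, |x| ≤ T / 2 → w' j x ≤ W := fun x hx => hW ⟨x, abs_le.1 hx, rfl⟩
  have hW0 : 0 ≤ W := (h.nonneg_right j 0).trans (hWx 0 (by rw [abs_zero]; positivity))
  refine ⟨W * D, mul_nonneg hW0 hD0, fun a x => ?_⟩
  rcases lt_or_ge (T / 2) |x| with hx | hx
  · rw [iteratedDeriv_eq_zero_of_lt (wave_eq_zero hT a) j hx, norm_zero, mul_zero]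
    positivity
  · rw [mul_assoc]
    exact mul_le_mul (hWx x hx) (hD a x) (norm_nonneg _) hW0

/-- The functions `wave T a`, as elements of `Y`. -/
def waveElem (h : WeightedPair X Y w w') {T : ℝ} (hT : 1 ≤ T) (a : ℤ) : Y.Elem :=
  ⟨wave T a, h.mem _ (wave_contDiff T a) (hasCompactSupport_of_abs (wave_eq_zero hT a))⟩

/-- With `y = x / T`, the factor `cutoff (4 * y)` is one on `|y| ≤ 1/4`, which contains the support
of `localized f T`, and zero for `|y| ≥ 1/2`. It removes the periodic copies in the Fourier series
without altering the central one. -/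
theorem tsum_wave (h : WeightedPair X Y w w') {T : ℝ} (hT : 1 ≤ T) (f : X.Elem) (x : ℝ) :
    ∑' a : ℤ, h.coeff hT a f * wave T a x = h.cutoffMul T hT f x := by
  have hT0 : 0 < T := by linarith
  have hx8 : localized f T (x / T) = h.cutoffMul T hT f x := by
    change cutoff (8 * (x / T)) * f (T * (x / T)) = cutoff (8 / T * x) * f x
    congr 2
    · ring
    · field_simp
  have hch : ∀ a : ℤ, character (a / T) x = character a (x / T) := fun a => by
    rw [character, character]
    congr 1
    push_cast
    ring
  have h4 : 4 / T * x = 4 * (x / T) := by ring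
  rcases le_or_gt |x / T| (1 / 2) with hy | hy
  · have h1 := tsum_character (h.localized_contDiff f T) (localized_eq_zero f T) hy
    have h2 : ∀ a : ℤ, h.coeff hT a f * wave T a x =
        cutoff (4 * (x / T)) * (h.coeff hT a f * character a (x / T)) := fun a => by
      rw [wave, hch, h4]
      ring
    have h3 : ∑' a : ℤ, h.coeff hT a f * character a (x / T) = localized f T (x / T) := h1
    rw [tsum_congr h2, tsum_mul_left, h3, ← hx8]
    rcases lt_or_ge |x / T| (1 / 4) with hz | hz
    · rw [cutoff_eq_one, one_mul]
      rw [abs_mul, abs_of_pos (by norm_num : (0 : ℝ) < 4)]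
      linarith
    · rw [localized_eq_zero _ _ _ hz, mul_zero]
  · have h2 : ∀ a : ℤ, h.coeff hT a f * wave T a x = 0 := fun a => by
      rw [wave, h4, cutoff_eq_zero, zero_mul, mul_zero]
      rw [abs_mul, abs_of_pos (by norm_num : (0 : ℝ) < 4)]
      linarith
    rw [tsum_congr h2, tsum_zero, ← hx8]
    rw [localized_eq_zero _ _ _ (by linarith)]

theorem summable_inv_sq : Summable fun a : ℤ => ((1 + |(a : ℝ)|) ^ 2)⁻¹ := by
  have h : Summable fun n : ℕ => ((1 + (n : ℝ)) ^ 2)⁻¹ := by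
    have h1 := (summable_nat_add_iff 1).2 (Real.summable_nat_pow_inv.2 one_lt_two)
    refine h1.congr fun n => ?_
    push_cast
    rw [add_comm]
  exact .of_nat_of_neg (by simpa using h) (by simpa using h)

/-- Two more orders of decay than needed buy a summable factor with a constant linear in a seminorm
of `f`. -/
theorem exists_coeff_decay (h : WeightedPair X Y w w') {T : ℝ} (hT : 1 ≤ T) (j : ℕ) :
    ∃ s : Seminorm ℂ X.Elem, Continuous s ∧ ∀ (a : ℤ) f,
      ‖h.coeff hT a f‖ * (1 + |(a : ℝ)|) ^ j ≤ s f * ((1 + |(a : ℝ)|) ^ 2)⁻¹ := by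
  obtain ⟨s, hs, hb⟩ := h.exists_coeffLinear_bound hT (j + 2)
  refine ⟨s, hs, fun a f => ?_⟩
  rw [← div_eq_mul_inv, le_div_iff₀ (by positivity), mul_assoc, ← pow_add]
  exact hb a f

theorem summable_coeff (h : WeightedPair X Y w w') {T : ℝ} (hT : 1 ≤ T) (j : ℕ) (f : X.Elem) :
    Summable fun a : ℤ => ‖h.coeff hT a f‖ * (1 + |(a : ℝ)|) ^ j := by
  obtain ⟨s, -, hb⟩ := h.exists_coeff_decay hT j
  exact .of_nonneg_of_le (fun a => by positivity) (fun a => hb a f) (summable_inv_sq.mul_left _)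

theorem contDiff_coeff_wave (h : WeightedPair X Y w w') {T : ℝ} (hT : 1 ≤ T) (f : X.Elem) (a : ℤ) :
    ContDiff ℝ ∞ fun x => h.coeff hT a f * wave T a x :=
  contDiff_const.mul (wave_contDiff T a)

theorem iteratedDeriv_coeff_wave (h : WeightedPair X Y w w') {T : ℝ} (hT : 1 ≤ T) (f : X.Elem)
    (a : ℤ) (j : ℕ) (x : ℝ) : iteratedDeriv j (fun x => h.coeff hT a f * wave T a x) x =
      h.coeff hT a f * iteratedDeriv j (wave T a) x :=
  iteratedDeriv_const_mul_field (h.coeff hT a f) (wave T a)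

/-- Each derivative of a wave costs one power of `1 + |a|`, and the coefficients decay faster than
any power, so the series may be differentiated term by term. -/
theorem hasSum_iteratedDeriv_wave (h : WeightedPair X Y w w') {T : ℝ} (hT : 1 ≤ T) (f : X.Elem)
    (j : ℕ) (x : ℝ) : HasSum (fun a : ℤ => h.coeff hT a f * iteratedDeriv j (wave T a) x)
      (iteratedDeriv j (h.cutoffMul T hT f : ℝ → ℂ) x) := by
  choose D hD0 hD using fun j => exists_wave_bound hT j
  have hb : ∀ (i : ℕ) (a : ℤ) (x : ℝ),
      ‖iteratedFDeriv ℝ i (fun x => h.coeff hT a f * wave T a x) x‖ ≤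
        D i * (‖h.coeff hT a f‖ * (1 + |(a : ℝ)|) ^ i) := by
    intro i a x
    rw [norm_iteratedFDeriv_eq_norm_iteratedDeriv, iteratedDeriv_coeff_wave, norm_mul]
    calc _ ≤ ‖h.coeff hT a f‖ * (D i * (1 + |(a : ℝ)|) ^ i) := by
          have := hD i a x
          gcongr
      _ = _ := by ring
  have hs : ∀ i, Summable fun a : ℤ => D i * (‖h.coeff hT a f‖ * (1 + |(a : ℝ)|) ^ i) :=
    fun i => (h.summable_coeff hT i f).mul_left _
  have h1 := iteratedFDeriv_tsum_apply (𝕜 := ℝ) (N := ⊤)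
    (f := fun (a : ℤ) x => h.coeff hT a f * wave T a x)
    (fun a => h.contDiff_coeff_wave hT f a) (fun i _ => hs i) (fun i a x _ => hb i a x)
    (k := j) le_top x
  have h2 : (fun y => ∑' a : ℤ, h.coeff hT a f * wave T a y) =
      (h.cutoffMul T hT f : ℝ → ℂ) := funext fun y => h.tsum_wave hT f y
  have hsum : Summable fun a : ℤ =>
      iteratedFDeriv ℝ j (fun x => h.coeff hT a f * wave T a x) x :=
    .of_norm_bounded (hs j) fun a => hb j a x
  rw [h2] at h1
  have h3 := hsum.hasSum
  rw [← h1] at h3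
  have h4 := h3.mapL (ContinuousMultilinearMap.apply ℝ (fun _ : Fin j => ℝ) ℂ fun _ => 1)
  simp only [ContinuousMultilinearMap.apply_apply, ← iteratedDeriv_eq_iteratedFDeriv,
    iteratedDeriv_coeff_wave] at h4
  exact h4

theorem family_wave_le (h : WeightedPair X Y w w') {T : ℝ} (hT : 1 ≤ T) (j : ℕ) :
    ∃ D, 0 ≤ D ∧ ∀ a, Y.family j (h.waveElem hT a) ≤ D * (1 + |(a : ℝ)|) ^ j := by
  obtain ⟨D, hD0, hD⟩ := h.exists_weighted_wave_bound hT j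
  exact ⟨D, hD0, fun a => h.upper j _ _ (by positivity) fun x => hD a x⟩

theorem hasExpansion_cutoffMul (h : WeightedPair X Y w w') {T : ℝ} (hT : 1 ≤ T) :
    HasExpansion (h.cutoffMul T hT) := by
  refine ⟨h.coeff hT, h.waveElem hT, h.coeff_isIntegralFunctional hT, fun j => ?_, fun f => ?_⟩
  · obtain ⟨D, hD0, hD⟩ := h.family_wave_le hT j
    obtain ⟨s, hs, hb⟩ := h.exists_coeff_decay hT j
    obtain ⟨p, hp, hpb⟩ := FunctionSpace.exists_sum_le {()}
      (fun _ => D * ∑' a : ℤ, ((1 + |(a : ℝ)|) ^ 2)⁻¹) (fun _ => s) fun _ => hs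
    refine ⟨p, hp, fun S f => le_trans ?_ (hpb f)⟩
    rw [Finset.sum_singleton]
    have hterm : ∀ a, Y.family j (h.coeff hT a f • h.waveElem hT a) ≤
        D * s f * ((1 + |(a : ℝ)|) ^ 2)⁻¹ := by
      intro a
      rw [map_smul_eq_mul]
      calc _ ≤ ‖h.coeff hT a f‖ * (D * (1 + |(a : ℝ)|) ^ j) := by
            have := hD a
            gcongr
        _ = D * (‖h.coeff hT a f‖ * (1 + |(a : ℝ)|) ^ j) := by ring
        _ ≤ D * (s f * ((1 + |(a : ℝ)|) ^ 2)⁻¹) := by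
            have := hb a f
            gcongr
        _ = _ := by ring
    calc Y.family j (∑ a ∈ S, h.coeff hT a f • h.waveElem hT a)
        ≤ ∑ a ∈ S, Y.family j (h.coeff hT a f • h.waveElem hT a) :=
          Finset.le_sum_of_subadditive _ (map_zero (Y.family j)).le (map_add_le_add (Y.family j)) _ _
      _ ≤ ∑ a ∈ S, D * s f * ((1 + |(a : ℝ)|) ^ 2)⁻¹ := Finset.sum_le_sum fun a _ => hterm a
      _ = D * s f * ∑ a ∈ S, ((1 + |(a : ℝ)|) ^ 2)⁻¹ := by rw [Finset.mul_sum]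
      _ ≤ D * s f * ∑' a : ℤ, ((1 + |(a : ℝ)|) ^ 2)⁻¹ := by
          have h1 : 0 ≤ s f := apply_nonneg _ _
          have h2 := summable_inv_sq.sum_le_tsum S fun a _ => by positivity
          exact mul_le_mul_of_nonneg_left h2 (mul_nonneg hD0 h1)
      _ = _ := by ring
  · refine (Y.withSeminorms.tendsto_nhds _ _).2 fun j ε hε => ?_
    obtain ⟨D, hD0, hD⟩ := h.exists_weighted_wave_bound hT j
    have hsum := (h.summable_coeff hT j f).mul_left D
    have htail := tendsto_tsum_compl_atTop_zero
      fun a : ℤ => D * (‖h.coeff hT a f‖ * (1 + |(a : ℝ)|) ^ j)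
    filter_upwards [htail.eventually_lt_const hε] with S hS
    refine lt_of_le_of_lt (h.upper j _ _ (tsum_nonneg fun a => by positivity) fun x => ?_) hS
    have hval : iteratedDeriv j
        ((∑ a ∈ S, h.coeff hT a f • h.waveElem hT a - h.cutoffMul T hT f : Y.Elem) : ℝ → ℂ) x =
        ∑ a ∈ S, h.coeff hT a f * iteratedDeriv j (wave T a) x -
          iteratedDeriv j (h.cutoffMul T hT f : ℝ → ℂ) x := by
      have h1 : ((∑ a ∈ S, h.coeff hT a f • h.waveElem hT a - h.cutoffMul T hT f : Y.Elem) : ℝ → ℂ) =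
          (fun x => ∑ a ∈ S, h.coeff hT a f * wave T a x) - (h.cutoffMul T hT f : ℝ → ℂ) := by
        ext y
        have h2 : ((∑ a ∈ S, h.coeff hT a f • h.waveElem hT a : Y.carrier) : ℝ → ℂ) =
            ∑ a ∈ S, h.coeff hT a f • wave T a := Submodule.coe_sum _ _ _
        have h3 := congrFun h2 y
        rw [Finset.sum_apply] at h3
        exact congrArg (· - (h.cutoffMul T hT f : ℝ → ℂ) y) h3
      have hj : ((j : ℕ∞) : WithTop ℕ∞) ≤ ∞ := by exact_mod_cast le_top
      have hw : ∀ a ∈ S, ContDiffAt ℝ j (fun x => h.coeff hT a f * wave T a x) x := fun a _ =>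
        ((h.contDiff_coeff_wave hT f a).of_le hj).contDiffAt
      have hcut : ContDiff ℝ ∞ (h.cutoffMul T hT f : ℝ → ℂ) :=
        (cutoff_scale_contDiff _).mul (h.contDiff f)
      rw [h1, iteratedDeriv_sub (ContDiffAt.sum hw) (hcut.of_le hj).contDiffAt,
        iteratedDeriv_fun_sum hw]
      simp only [iteratedDeriv_coeff_wave]
    have hs := h.hasSum_iteratedDeriv_wave hT f j x
    rw [hval, norm_sub_rev, ← hs.tsum_eq, ← hs.summable.sum_add_tsum_compl (s := S), add_sub_cancel_left]
    -- After multiplication by the weight the terms are bounded independently of `x`, so the tail of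
    -- one numerical series bounds the seminorm of the remainder.
    have hle : ∀ a : ℤ, ‖w' j x • (h.coeff hT a f * iteratedDeriv j (wave T a) x)‖ ≤
        D * (‖h.coeff hT a f‖ * (1 + |(a : ℝ)|) ^ j) := by
      intro a
      rw [norm_smul, norm_mul, Real.norm_of_nonneg (h.nonneg_right j x)]
      have := hD a x
      calc _ = ‖h.coeff hT a f‖ * (w' j x * ‖iteratedDeriv j (wave T a) x‖) := by ring
        _ ≤ ‖h.coeff hT a f‖ * (D * (1 + |(a : ℝ)|) ^ j) := by gcongr
        _ = _ := by ring
    have h5 := tsum_of_norm_bounded (hsum.subtype (fun a => a ∉ S)).hasSum fun a => hle a.1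
    rw [tsum_const_smul'' (w' j x), norm_smul, Real.norm_of_nonneg (h.nonneg_right j x)] at h5
    exact h5

theorem hasApproximation (h : WeightedPair X Y w w') :
    HasApproximation (FunctionSpace.incl h.le) := by
  refine ⟨fun r => h.cutoffMul ((r : ℝ) + 1) (by linarith [r.cast_nonneg (α := ℝ)]),
    fun r => h.hasExpansion_cutoffMul _, fun j => ?_, h.tendsto_cutoffMul⟩
  obtain ⟨s, hs, hb⟩ := h.exists_cutoffLinear_bound j
  exact ⟨s, hs, fun r f => hb _ (by linarith [r.cast_nonneg (α := ℝ)]) f⟩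

end WeightedPair

/-! ### Weights of the symbol spaces -/

theorem hasCompactSupport_iteratedDeriv {g : ℝ → ℂ} (hc : HasCompactSupport g) (k : ℕ) :
    HasCompactSupport (iteratedDeriv k g) := by
  rw [iteratedDeriv_eq_equiv_comp]
  exact (hc.iteratedFDeriv k).comp_left (map_zero _)

theorem exists_weighted_bound_of_compactSupport {g : ℝ → ℂ} (hg : ContDiff ℝ ∞ g)
    (hc : HasCompactSupport g) (k : ℕ) {v : ℝ → ℝ} (hv : Continuous v) :
    ∃ C, ∀ x, ‖v x • iteratedDeriv k g x‖ ≤ C := by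
  have hk : Continuous (iteratedDeriv k g) :=
    hg.continuous_iteratedDeriv k (by exact_mod_cast le_top)
  have hs : HasCompactSupport fun x => v x • iteratedDeriv k g x :=
    (hasCompactSupport_iteratedDeriv hc k).smul_left (f := v)
  exact hs.exists_bound_of_continuous (hv.smul hk)

theorem continuous_symbolWeight (a : ℤ) : Continuous fun x : ℝ => (1 + |x|) ^ a :=
  (continuous_const.add continuous_abs).zpow₀ a fun x =>
    Or.inl (show 1 + |x| ≠ 0 by positivity)

/-- Raising the order by one lowers each weight by exactly one factor `1 + |x|`, so `ratio` is an
equality with constant one. -/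
theorem symbolSpace_weightedPair {m m' : ℤ} (hm : m' = m + 1) :
    WeightedPair (symbolSpace m) (symbolSpace m') (fun j x => (1 + |x|) ^ (j - m : ℤ))
      fun j x => (1 + |x|) ^ (j - m' : ℤ) where
  le := symbolSpace_le (by omega)
  contDiff f := f.2.1
  continuous_left j := continuous_symbolWeight _
  pos_left j x := by positivity
  continuous_right j := continuous_symbolWeight _
  nonneg_right j x := by positivity
  lower j := ⟨symbolSeminorm m j, (symbolSpace m).continuous_family j,
    fun f x => le_ciSup (symbol_bddAbove f j) x⟩
  mem g hg hc := by
    refine ⟨hg, fun k => ?_⟩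
    obtain ⟨C, hC⟩ := exists_weighted_bound_of_compactSupport hg hc k
      (continuous_symbolWeight (k - m'))
    refine ⟨C, fun x => ?_⟩
    have h1 := hC x
    rw [norm_smul, Real.norm_of_nonneg (by positivity)] at h1
    calc ‖iteratedDeriv k g x‖
        = (1 + |x|) ^ (k - m' : ℤ) * ‖iteratedDeriv k g x‖ * (1 + |x|) ^ (m' - k : ℤ) := by
          rw [mul_right_comm, symbol_weight_mul, one_mul]
      _ ≤ C * (1 + |x|) ^ (m' - k : ℤ) := by gcongr
  upper j g B hB h := ciSup_le h
  ratio i j hij := by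
    refine ⟨1, zero_le_one, fun x => le_of_eq ?_⟩
    have h0 : (1 + |x|) ≠ 0 := by positivity
    rw [one_mul, ← zpow_natCast, ← zpow_add₀ h0, ← zpow_add_one₀ h0]
    congr 1
    push_cast [hij]
    omega

/-! ### Weights of the spaces of Gaussian decay -/

/-- Integrate the derivative of `(1 - t) * F (x + σ * t)` over `[0, 1]`: the boundary term at `t =
1` vanishes and the one at `t = 0` is `F x`. -/
theorem norm_le_integral_unit {F F' : ℝ → ℂ} (hF : ∀ y, HasDerivAt F (F' y) y)
    (hc : Continuous F') {σ : ℝ} (hσ : |σ| = 1) (x : ℝ) :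
    ‖F x‖ ≤ ∫ t in (0 : ℝ)..1, (‖F (x + σ * t)‖ + ‖F' (x + σ * t)‖) := by
  have hFc : Continuous F := continuous_iff_continuousAt.2 fun y => (hF y).continuousAt
  let u : ℝ → ℂ := fun t => ((1 - t : ℝ) : ℂ) * F (x + σ * t)
  let u' : ℝ → ℂ := fun t => (-1) * F (x + σ * t) + ((1 - t : ℝ) : ℂ) * (σ • F' (x + σ * t))
  have hu : ∀ t, HasDerivAt u (u' t) t := by
    intro t
    have h1 : HasDerivAt (fun t : ℝ => ((1 - t : ℝ) : ℂ)) (-1) t := by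
      have := ((hasDerivAt_id t).const_sub 1).ofReal_comp
      simpa using this
    have h2 : HasDerivAt (fun t : ℝ => x + σ * t) σ t := by
      simpa using ((hasDerivAt_id t).const_mul σ).const_add x
    exact h1.mul ((hF (x + σ * t)).scomp t h2)
  have hu'c : Continuous u' := by fun_prop
  have h := intervalIntegral.integral_eq_sub_of_hasDerivAt (a := 0) (b := 1) (fun t _ => hu t)
    (hu'c.intervalIntegrable 0 1)
  have h3 : F x = -∫ t in (0 : ℝ)..1, u' t := by
    rw [h]
    simp [u]
  rw [h3, norm_neg]
  refine (intervalIntegral.norm_integral_le_integral_norm zero_le_one).trans ?_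
  refine intervalIntegral.integral_mono_on zero_le_one (hu'c.norm.intervalIntegrable 0 1)
    (Continuous.intervalIntegrable (by fun_prop) 0 1) fun t ht => ?_
  refine (norm_add_le _ _).trans (add_le_add ?_ ?_)
  · simp
  · rw [norm_mul, norm_smul, Real.norm_eq_abs, hσ, one_mul, Complex.norm_real, Real.norm_eq_abs]
    refine mul_le_of_le_one_left (norm_nonneg _) ?_
    rw [abs_le]
    constructor <;> linarith [ht.1, ht.2]

/-- Nonnegativity of the variance on a probability space, a form of the Cauchy–Schwarz inequality.
-/
theorem integral_unit_le_sqrt {G : ℝ → ℝ} (hG : Continuous G) :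
    ∫ t in (0 : ℝ)..1, G t ≤ √(∫ t in (0 : ℝ)..1, G t ^ 2) := by
  refine Real.le_sqrt_of_sq_le ?_
  set c := ∫ t in (0 : ℝ)..1, G t
  have h0 : 0 ≤ ∫ t in (0 : ℝ)..1, (G t - c) ^ 2 :=
    intervalIntegral.integral_nonneg zero_le_one fun t _ => sq_nonneg _
  have h1 : ∫ t in (0 : ℝ)..1, (G t - c) ^ 2 =
      (∫ t in (0 : ℝ)..1, G t ^ 2) - 2 * c * c + c ^ 2 := by
    have h2 : ∀ t, (G t - c) ^ 2 = G t ^ 2 - 2 * c * G t + c ^ 2 := fun t => by ring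
    simp only [h2]
    rw [intervalIntegral.integral_add, intervalIntegral.integral_sub,
      intervalIntegral.integral_const_mul, intervalIntegral.integral_const]
    · simp [c]
    all_goals exact Continuous.intervalIntegrable (by fun_prop) 0 1
  nlinarith

theorem integral_unit_le_integral {H : ℝ → ℝ} (hH : Integrable H) (h0 : ∀ y, 0 ≤ H y) {σ : ℝ}
    (hσ : |σ| = 1) (x : ℝ) : ∫ t in (0 : ℝ)..1, H (x + σ * t) ≤ ∫ y, H y := by
  have key : Integrable (fun t => H (x + σ * t)) ∧ ∫ t, H (x + σ * t) = ∫ y, H y := by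
    rcases (abs_eq zero_le_one).1 hσ with rfl | rfl
    · simp only [one_mul]
      exact ⟨hH.comp_add_left x, integral_add_left_eq_self H x⟩
    · simp only [neg_mul, one_mul, ← sub_eq_add_neg]
      exact ⟨hH.comp_sub_left x, integral_sub_left_eq_self H volume x⟩
  rw [intervalIntegral.integral_of_le zero_le_one, ← key.2]
  exact setIntegral_le_integral key.1 (Eventually.of_forall fun t => h0 _)

theorem decay_integrable {ε : ℝ} (f : decayCarrier ε) (k : ℕ) :
    Integrable fun y => ‖weightedDeriv ε k f.1 y‖ ^ 2 := by
  simpa only [norm_weightedDeriv_sq] using f.2.2 k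

theorem continuous_weightedDeriv (ε : ℝ) (k : ℕ) {f : ℝ → ℂ} (hf : ContDiff ℝ ∞ f) :
    Continuous (weightedDeriv ε k f) := by
  have := hf.continuous_iteratedDeriv k (by exact_mod_cast le_top)
  unfold weightedDeriv
  fun_prop

/-- The weighted `L²` norms of two consecutive derivatives control a weighted supremum. -/
theorem norm_weightedDeriv_le {ε : ℝ} (hε : 0 ≤ ε) (f : decayCarrier ε) (j : ℕ) (x : ℝ) :
    Real.exp (ε * x ^ 2 / 2) * ‖iteratedDeriv j f.1 x‖ ≤
      decaySeminorm ε j f + decaySeminorm ε (j + 1) f := by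
  -- The unit segment is taken pointing away from the origin. Along it the Gaussian weight is at
  -- least its value at `x`, so the weight can be moved inside the integral.
  obtain ⟨σ, hσ, hσx⟩ : ∃ σ : ℝ, |σ| = 1 ∧ 0 ≤ σ * x := by
    rcases le_total 0 x with hx | hx
    · exact ⟨1, by simp, by linarith⟩
    · exact ⟨-1, by simp, by linarith⟩
  have hd : ∀ y, HasDerivAt (iteratedDeriv j f.1) (iteratedDeriv (j + 1) f.1 y) y := by
    intro y
    rw [iteratedDeriv_succ]
    exact ((f.2.1.differentiable_iteratedDeriv j (by exact_mod_cast WithTop.coe_lt_top j)) y).hasDerivAt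
  have hc := fun k => f.2.1.continuous_iteratedDeriv k (by exact_mod_cast le_top)
  have hw := fun k => continuous_weightedDeriv ε k f.2.1
  have hone : ∀ k, ∫ t in (0 : ℝ)..1, ‖weightedDeriv ε k f.1 (x + σ * t)‖ ≤ decaySeminorm ε k f := by
    intro k
    have hcont : Continuous fun t => ‖weightedDeriv ε k f.1 (x + σ * t)‖ :=
      ((hw k).comp (by fun_prop)).norm
    refine (integral_unit_le_sqrt hcont).trans (Real.sqrt_le_sqrt ?_)
    refine (integral_unit_le_integral (decay_integrable f k) (fun y => by positivity) hσ x).trans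
      (le_of_eq ?_)
    simp only [norm_weightedDeriv_sq]
  calc Real.exp (ε * x ^ 2 / 2) * ‖iteratedDeriv j f.1 x‖
      ≤ Real.exp (ε * x ^ 2 / 2) * ∫ t in (0 : ℝ)..1,
          (‖iteratedDeriv j f.1 (x + σ * t)‖ + ‖iteratedDeriv (j + 1) f.1 (x + σ * t)‖) := by
        have := norm_le_integral_unit hd (hc (j + 1)) hσ x
        gcongr
    _ = ∫ t in (0 : ℝ)..1, Real.exp (ε * x ^ 2 / 2) *
          (‖iteratedDeriv j f.1 (x + σ * t)‖ + ‖iteratedDeriv (j + 1) f.1 (x + σ * t)‖) := by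
        rw [intervalIntegral.integral_const_mul]
    _ ≤ ∫ t in (0 : ℝ)..1,
          (‖weightedDeriv ε j f.1 (x + σ * t)‖ + ‖weightedDeriv ε (j + 1) f.1 (x + σ * t)‖) := by
        have h1 := hc j
        have h2 := hc (j + 1)
        have h3 := hw j
        have h4 := hw (j + 1)
        refine intervalIntegral.integral_mono_on zero_le_one
          (Continuous.intervalIntegrable (by fun_prop) 0 1)
          (Continuous.intervalIntegrable (by fun_prop) 0 1) fun t ht => ?_
        have hexp : Real.exp (ε * x ^ 2 / 2) ≤ Real.exp (ε * (x + σ * t) ^ 2 / 2) := by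
          have h5 : x ^ 2 ≤ (x + σ * t) ^ 2 := by nlinarith [mul_nonneg hσx ht.1, sq_nonneg (σ * t)]
          gcongr
        simp only [weightedDeriv, norm_smul, Real.norm_eq_abs, Real.abs_exp]
        rw [← mul_add]
        gcongr
    _ = (∫ t in (0 : ℝ)..1, ‖weightedDeriv ε j f.1 (x + σ * t)‖) +
          ∫ t in (0 : ℝ)..1, ‖weightedDeriv ε (j + 1) f.1 (x + σ * t)‖ := by
        have h3 := hw j
        have h4 := hw (j + 1)
        exact intervalIntegral.integral_add (Continuous.intervalIntegrable (by fun_prop) 0 1)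
          (Continuous.intervalIntegrable (by fun_prop) 0 1)
    _ ≤ _ := add_le_add (hone j) (hone (j + 1))

/-- The extra factor `1 + |x|` makes the square integrable, since `(1 + |x|) ^ 2 ≥ 1 + x ^ 2`; the
normalization `√π` cancels `∫ (1 + x ^ 2)⁻¹ = π`. -/
theorem decaySeminorm_le {ε : ℝ} (g : decayCarrier ε) (j : ℕ) {B : ℝ} (hB : 0 ≤ B)
    (h : ∀ x, √Real.pi * (Real.exp (ε * x ^ 2 / 2) * (1 + |x|)) * ‖iteratedDeriv j g.1 x‖ ≤ B) :
    decaySeminorm ε j g ≤ B := by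
  refine Real.sqrt_le_iff.2 ⟨hB, ?_⟩
  have hpi := Real.pi_pos
  have hle : ∀ x : ℝ, Real.exp (ε * x ^ 2) * ‖iteratedDeriv j g.1 x‖ ^ 2 ≤
      B ^ 2 / Real.pi * (1 + x ^ 2)⁻¹ := by
    intro x
    have h1 : (√Real.pi * (Real.exp (ε * x ^ 2 / 2) * (1 + |x|)) * ‖iteratedDeriv j g.1 x‖) ^ 2 ≤ B ^ 2 :=
      pow_le_pow_left₀ (by positivity) (h x) 2
    have h2 : Real.exp (ε * x ^ 2 / 2) ^ 2 = Real.exp (ε * x ^ 2) := by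
      rw [← Real.exp_nat_mul]
      congr 1
      push_cast
      ring
    have h3 : 1 + x ^ 2 ≤ (1 + |x|) ^ 2 := by nlinarith [abs_nonneg x, sq_abs x]
    rw [← div_eq_mul_inv, le_div_iff₀ (by positivity), le_div_iff₀ hpi]
    rw [mul_pow, mul_pow, mul_pow, Real.sq_sqrt hpi.le, h2] at h1
    refine le_trans ?_ h1
    calc _ = Real.pi * (Real.exp (ε * x ^ 2) * (1 + x ^ 2)) * ‖iteratedDeriv j g.1 x‖ ^ 2 := by ring
      _ ≤ _ := by gcongr
  calc _ ≤ ∫ x : ℝ, B ^ 2 / Real.pi * (1 + x ^ 2)⁻¹ :=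
        integral_mono (g.2.2 j) (integrable_inv_one_add_sq.const_mul _) hle
    _ = B ^ 2 := by
        rw [integral_const_mul, integral_univ_inv_one_add_sq]
        field_simp

/-- Two factors `1 + |x|` must be absorbed: one from bounding the `L²` norm by a supremum, one from
`ratio`. The drop from `ε` to `ε'` supplies a Gaussian that dominates both. -/
theorem decaySpace_weightedPair {ε ε' : ℝ} (hε' : 0 < ε') (h : ε' < ε) :
    WeightedPair (decaySpace ε) (decaySpace ε') (fun _ x => Real.exp (ε * x ^ 2 / 2))
      fun _ x => √Real.pi * (Real.exp (ε' * x ^ 2 / 2) * (1 + |x|)) where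
  le := decaySpace_le h.le
  contDiff f := f.2.1
  continuous_left j := by fun_prop
  pos_left j x := Real.exp_pos _
  continuous_right j := by fun_prop
  nonneg_right j x := by positivity
  lower j := by
    have hj := (decaySpace ε).continuous_family j
    have hj1 := (decaySpace ε).continuous_family (j + 1)
    exact ⟨(decaySpace ε).family j + (decaySpace ε).family (j + 1), hj.add hj1,
      fun f x => norm_weightedDeriv_le (hε'.trans h).le f j x⟩
  mem g hg hc := by
    refine ⟨hg, fun k => ?_⟩
    have hw := continuous_weightedDeriv ε' k hg
    have hs : HasCompactSupport (weightedDeriv ε' k g) :=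
      (hasCompactSupport_iteratedDeriv hc k).smul_left (f := fun x => Real.exp (ε' * x ^ 2 / 2))
    exact (weightedDeriv_memLp_iff ε' k hg).1 (hw.memLp_of_hasCompactSupport hs)
  upper j g B hB hb := decaySeminorm_le g j hB hb
  ratio i j hij := by
    -- This is the gap between the exponents `ε / 2` and `ε' / 2`. Then `(1 + |x|) ^ 2 ≤ 2 * (1 + 1
    -- / δ) * (1 + δ * x ^ 2)`, and the last factor is at most `exp (δ * x ^ 2)`.
    set δ := (ε - ε') / 2 with hδ
    have hδ0 : 0 < δ := by rw [hδ]; linarith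
    refine ⟨√Real.pi * (2 * (1 + 1 / δ)), by positivity, fun x => ?_⟩
    have h1 : (1 + |x|) ^ 2 ≤ 2 * (1 + x ^ 2) := by nlinarith [sq_abs x, sq_nonneg (|x| - 1)]
    have h2 : 1 + x ^ 2 ≤ (1 + 1 / δ) * (1 + δ * x ^ 2) := by
      have : (1 + 1 / δ) * (1 + δ * x ^ 2) = 1 + x ^ 2 + (1 / δ + δ * x ^ 2) := by field_simp; ring
      rw [this]
      have : 0 ≤ 1 / δ + δ * x ^ 2 := by positivity
      linarith
    have h3 : 1 + δ * x ^ 2 ≤ Real.exp (δ * x ^ 2) := by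
      rw [add_comm]
      exact Real.add_one_le_exp _
    have h4 : Real.exp (ε' * x ^ 2 / 2) * Real.exp (δ * x ^ 2) = Real.exp (ε * x ^ 2 / 2) := by
      rw [← Real.exp_add, hδ]
      congr 1
      ring
    have h5 : (1 : ℝ) ≤ (1 + |x|) ^ (j - i) := one_le_pow₀ (by linarith [abs_nonneg x])
    calc √Real.pi * (Real.exp (ε' * x ^ 2 / 2) * (1 + |x|)) * (1 + |x|)
        = √Real.pi * Real.exp (ε' * x ^ 2 / 2) * (1 + |x|) ^ 2 := by ring
      _ ≤ √Real.pi * Real.exp (ε' * x ^ 2 / 2) * (2 * ((1 + 1 / δ) * Real.exp (δ * x ^ 2))) := by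
          have h6 : (1 + |x|) ^ 2 ≤ 2 * ((1 + 1 / δ) * Real.exp (δ * x ^ 2)) :=
            h1.trans (mul_le_mul_of_nonneg_left
              (h2.trans (mul_le_mul_of_nonneg_left h3 (by positivity))) (by norm_num))
          gcongr
      _ = √Real.pi * (2 * (1 + 1 / δ)) *
            (Real.exp (ε' * x ^ 2 / 2) * Real.exp (δ * x ^ 2) * 1) := by ring
      _ ≤ _ := by
          rw [h4]
          gcongr

/-! ### The factors of `𝓕_k(m₀, …, m_n)` -/

/-- The multi-index `(m₀ + 1, …, m_n + 1)`. -/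
def MultiIndex.succ {n : ℕ} {k : Fin (n + 1)} (m : MultiIndex n k) : MultiIndex n k :=
  ⟨fun j => m.1 j + 1, Nat.succ_pos _⟩

theorem MultiIndex.le_succ {n : ℕ} {k : Fin (n + 1)} (m : MultiIndex n k) : m ≤ m.succ :=
  fun j => Nat.le_succ (m.1 j)

theorem factor_weightedPair {n : ℕ} (k : Fin (n + 1)) (m : MultiIndex n k) (j : Fin (n + 1)) :
    ∃ w w', WeightedPair (factor k m j) (factor k m.succ j) w w' := by
  unfold factor
  split_ifs with hjk
  · subst hjk
    have h0 : (0 : ℝ) < m.1 j := by exact_mod_cast m.2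
    have h1 : ((m.succ.1 j : ℕ) : ℝ) = m.1 j + 1 := Nat.cast_succ _
    refine ⟨_, _, decaySpace_weightedPair ?_ ?_⟩
    · rw [h1]
      positivity
    · rw [h1]
      exact one_div_lt_one_div_of_lt h0 (lt_add_one _)
  · exact ⟨_, _, symbolSpace_weightedPair (Nat.cast_succ _)⟩

theorem factor_embedsSmooth {n : ℕ} (k : Fin (n + 1)) (m : MultiIndex n k) (j : Fin (n + 1)) :
    (factor k m j).EmbedsSmooth := by
  obtain ⟨_, _, h⟩ := factor_weightedPair k m j
  exact h.embedsSmooth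

theorem factor_hasApproximation {n : ℕ} (k : Fin (n + 1)) (m : MultiIndex n k) (j : Fin (n + 1)) :
    HasApproximation (FunctionSpace.incl (factor_le m.le_succ j)) := by
  obtain ⟨_, _, h⟩ := factor_weightedPair k m j
  exact h.hasApproximation

/-! ### The natural map on the inductive limit -/

section Limit

variable {n : ℕ} (k : Fin (n + 1))

instance : IsDirectedOrder (MultiIndex n k) :=
  ⟨fun m m' => ⟨⟨m.1 ⊔ m'.1, lt_sup_of_lt_left m.2⟩, le_sup_left (α := Fin (n + 1) → ℕ),
    le_sup_right (α := Fin (n + 1) → ℕ)⟩⟩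

instance : Nonempty (MultiIndex n k) := ⟨⟨fun _ => 1, one_pos⟩⟩

theorem FLim.exists_of (z : FLim n k) : ∃ m t, FLim.of k m t = z :=
  Module.DirectLimit.exists_of z

theorem FLim.of_transition {m m' : MultiIndex n k} (h : m ≤ m') (t : FStep k m) :
    FLim.of k m' (transition k m m' h t) = FLim.of k m t :=
  Module.DirectLimit.of_f

/-- The natural map `𝓕_k(m₀, …, m_n) → C^∞(ℝⁿ⁺¹)`. -/
def stepMap (m : MultiIndex n k) : FStep k m →L[ℂ] SmoothFun (n + 1) :=
  natural (factor_embedsSmooth k m)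

theorem stepMap_elemTensor (m : MultiIndex n k) (f : ∀ j, (factor k m j).Elem)
    (x : Fin (n + 1) → ℝ) : stepMap k m (elemTensor f) x = ∏ j, f j (x j) := by
  rw [stepMap, natural_elemTensor, prodFun_apply]

theorem transition_elemTensor {m m' : MultiIndex n k} (h : m ≤ m') (f : ∀ j, (factor k m j).Elem) :
    transition k m m' h (elemTensor f) =
      elemTensor fun j => FunctionSpace.incl (factor_le h j) (f j) := by
  refine (ContinuousLinearMap.completion_apply_coe _ _).trans ?_
  exact congrArg _ (ProjTensor.mapLinear_tprod _ f)

theorem stepMap_transition {m m' : MultiIndex n k} (h : m ≤ m') (t : FStep k m) :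
    stepMap k m' (transition k m m' h t) = stepMap k m t := by
  have h1 : (stepMap k m').toLinearMap ∘ₗ transition k m m' h = (stepMap k m).toLinearMap := by
    refine complTensor_hom_ext ((stepMap k m').continuous.comp
      (ProjTensor.map fun j => FunctionSpace.incl (factor_le h j)).completion.continuous)
      (stepMap k m).continuous fun f => SmoothFun.ext fun x => ?_
    rw [LinearMap.comp_apply, transition_elemTensor]
    exact (stepMap_elemTensor k m' _ x).trans (stepMap_elemTensor k m f x).symm
  exact LinearMap.congr_fun h1 t

/-- The natural map `𝓕_k⁽ⁿ⁾ → C^∞(ℝⁿ⁺¹)`, as a linear map. -/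
def limLinear : FLim n k →ₗ[ℂ] SmoothFun (n + 1) :=
  (Module.DirectLimit.lift ℂ (MultiIndex n k) (FStep k) (transition k)
    (fun m => (stepMap k m).toLinearMap) fun _ _ h t => stepMap_transition k h t :
    Module.DirectLimit (FStep k) (transition k) →ₗ[ℂ] SmoothFun (n + 1))

theorem limLinear_of (m : MultiIndex n k) (t : FStep k m) :
    limLinear k (FLim.of k m t) = stepMap k m t :=
  Module.DirectLimit.lift_of _ _ _

theorem limFamily_withSeminorms : WithSeminorms (limFamily n k) := ⟨rfl⟩

/-- The natural map `𝓕_k⁽ⁿ⁾ → C^∞(ℝⁿ⁺¹)`. -/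
def limMap : FLim n k →L[ℂ] SmoothFun (n + 1) where
  toLinearMap := limLinear k
  cont := by
    have := (limFamily_withSeminorms k).topologicalAddGroup
    refine (smoothFun_withSeminorms (n + 1)).continuous_of_continuous_comp (limLinear k) fun q => ?_
    refine (limFamily_withSeminorms k).continuous_seminorm
      ⟨(smoothFamily (n + 1) q).comp (limLinear k), fun m => ?_⟩
    simp only [Seminorm.comp_apply, limLinear_of]
    exact (smoothSeminorm_continuous q.1 q.2).comp (stepMap k m).continuous

theorem limMap_of (m : MultiIndex n k) (t : FStep k m) :
    limMap k (FLim.of k m t) = stepMap k m t :=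
  limLinear_of k m t

theorem limMap_isNaturalMap : IsNaturalMap (limMap k) := fun m f x => by
  rw [limMap_of, stepMap_elemTensor]

theorem FLim.continuous_of (m : MultiIndex n k) : Continuous (FLim.of k m) :=
  (limFamily_withSeminorms k).continuous_of_continuous_comp (FLim.of k m) fun p => p.2 m

theorem IsNaturalMap.eq_limMap {Ψ : FLim n k →L[ℂ] SmoothFun (n + 1)} (hΨ : IsNaturalMap Ψ) :
    Ψ = limMap k := by
  refine ContinuousLinearMap.ext fun z => ?_
  obtain ⟨m, t, rfl⟩ := FLim.exists_of k z
  have h1 : Ψ.toLinearMap ∘ₗ FLim.of k m = (limMap k).toLinearMap ∘ₗ FLim.of k m :=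
    complTensor_hom_ext (Ψ.continuous.comp (FLim.continuous_of k m))
      ((limMap k).continuous.comp (FLim.continuous_of k m)) fun f => SmoothFun.ext fun x =>
        (hΨ m f x).trans (limMap_isNaturalMap k m f x).symm
  exact LinearMap.congr_fun h1 t

/-- A representative `t` with natural image zero is killed by the transition to `m.succ`, hence its
class in the limit is zero. -/
theorem limMap_injective : Function.Injective (limMap k) := by
  refine (injective_iff_map_eq_zero (limMap k)).2 fun z hz => ?_
  obtain ⟨m, t, rfl⟩ := FLim.exists_of k z
  rw [limMap_of] at hz
  have h0 : transition k m m.succ m.le_succ t = 0 :=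
    completion_map_eq_zero_of_hasApproximation (factor_embedsSmooth k m) _
      (factor_hasApproximation k m) t hz
  rw [← FLim.of_transition k m.le_succ, h0, map_zero]

end Limit

end TensorSymbol

end


/-! ### The natural maps and the sum of their images -/

theorem mainTheorem6 (n : ℕ) :
    ∃ Φ : ∀ k : Fin (n + 1), TensorSymbol.FLim n k →L[ℂ] TensorSymbol.SmoothFun (n + 1),
      (∀ k, TensorSymbol.IsNaturalMap (Φ k)) ∧
      (∀ k (Ψ : TensorSymbol.FLim n k →L[ℂ] TensorSymbol.SmoothFun (n + 1)),
        TensorSymbol.IsNaturalMap Ψ → Ψ = Φ k) ∧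
      (∀ k, Function.Injective (Φ k)) ∧
      TensorSymbol.FSum n = ⨆ k, LinearMap.range (Φ k).toLinearMap := by
  refine ⟨fun k => TensorSymbol.limMap k, fun k => TensorSymbol.limMap_isNaturalMap k,
    fun k Ψ hΨ => hΨ.eq_limMap k, fun k => TensorSymbol.limMap_injective k, ?_⟩
  unfold TensorSymbol.FSum
  -- For each `k` the supremum over natural maps has a single term, by uniqueness.
  refine iSup_congr fun k => le_antisymm ?_ ?_
  · refine iSup_le fun Ψ => iSup_le fun hΨ => ?_
    rw [hΨ.eq_limMap k]
  · exact le_iSup_of_le (TensorSymbol.limMap k)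
      (le_iSup_of_le (TensorSymbol.limMap_isNaturalMap k) le_rfl)
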